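/- Let $G$ be a finite simple graph with vertex set $V$. For $v\in V$ let $N[v]$ be the set consisting of $v$ and its neighbours. An \emph{identifying code} of $G$ is a set $C\subseteq V$ such that every vertex belongs to $C$ or has a neighbour in $C$, and for all distinct $u,v\in V$ some vertex of $C$ belongs to exactly one of $N[u]$ and $N[v]$. If $G$ has an identifying code, $\gamma^{\mathrm{ID}}(G)$ denotes the minimum size of an identifying code of $G$. \emph{Appending a $3$-star} onto a vertex $v$ of a graph means adding three new vertices $c,a,b$ and the edges $vc$, $ca$, $cb$. For integers $2\ge x_1\ge x_2\ge x_3\ge 0$, let $A(x_1,x_2,x_3)$ be the tree obtained from the star $K_{1,3}$ with leaves $v_1,v_2,v_3$ by appending $x_i$ $3$-stars onto $v_i$ for each $i\in\{1,2,3\}$. For $j\ge 1$ let $B(j)$ be the tree obtained from a path on $4$ vertices by appending $j$ $3$-stars onto one of its end vertices. Let $\mathcal T_3$ be the set of the following $12$ trees of maximum degree $3$: the ten trees $A(x_1,x_2,x_3)$ with $2\ge x_1\ge x_2\ge x_3\ge 0$ (so that $A(0,0,0)=K_{1,3}$), together with $B(1)$ and $B(2)$. For $\Delta\ge 4$ let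 $\mathcal T_\Delta=\{K_{1,\Delta}\}$. \textbf{Theorem.} Let $G$ be a tree of order $n$ and of maximum degree $\Delta\ge 3$. Then $G$ has an identifying code. If $G$ is isomorphic to a tree in $\mathcal T_\Delta$, then \[ \gamma^{\mathrm{ID}}(G)=\left(\frac{\Delta-1}{\Delta}\right)n+\frac1\Delta . \] If $G$ is not isomorphic to any tree in $\mathcal T_\Delta$, then \[ \gamma^{\mathrm{ID}}(G)\le\left(\frac{\Delta-1}{\Delta}\right)n . \] In particular, $\gamma^{\mathrm{ID}}(G)\le\left(\frac{\Delta-1}{\Delta}\right)n+\frac1\Delta$ for every tree $G$ of order $n$ and of maximum degree $\Delta\ge 3$. -/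

import Mathlib

/-- The closed neighbourhood `N[v] = {v} ∪ N(v)` of a vertex `v` of a graph `G`. -/
def closedNbhd {V : Type*} (G : SimpleGraph V) (v : V) : Set V :=
  {w | w = v ∨ G.Adj v w}

/-- `C` is a dominating set of `G`: every vertex is in `C` or has a neighbour in `C`. -/
def DominatesAll {V : Type*} (G : SimpleGraph V) (C : Finset V) : Prop :=
  ∀ v : V, v ∈ C ∨ ∃ w ∈ C, G.Adj v w

/-- `C` is a separating set of `G`: for any two distinct vertices `u`, `v`, some vertex of `C`
belongs to exactly one of `N[u]` and `N[v]`. -/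
def SeparatesAll {V : Type*} (G : SimpleGraph V) (C : Finset V) : Prop :=
  ∀ u v : V, u ≠ v → ∃ w ∈ C, Xor (w ∈ closedNbhd G u) (w ∈ closedNbhd G v)

/-- An identifying code of `G` is a vertex subset that is both dominating and separating. -/
def IsIdentifyingCode {V : Type*} (G : SimpleGraph V) (C : Finset V) : Prop :=
  DominatesAll G C ∧ SeparatesAll G C

/-- The identification number of `G`: the minimum size of an identifying code of `G`
(meaningful when `G` has an identifying code; the value is `0` by convention otherwise). -/
noncomputable def identificationNumber {V : Type*} (G : SimpleGraph V) : ℕ :=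
  sInf {k | ∃ C : Finset V, IsIdentifyingCode G C ∧ C.card = k}

/-- The graph on `{0, …, m - 1}` whose edges are the pairs in the list `E`. -/
def graphOfEdges (m : ℕ) (E : List (Fin m × Fin m)) : SimpleGraph (Fin m) :=
  SimpleGraph.fromRel fun a b => (a, b) ∈ E

/-! Twelve explicit trees of maximum degree 3. A line `(v, c), (c, a), (c, b)` appends a 3-star
with centre `c` and leaves `v`, `a`, `b` by its leaf `v` onto an earlier vertex `v`. -/

/-- The star `K_{1,3}` with centre `0` and leaves `1`, `2`, `3`. -/
def exTree0 : SimpleGraph (Fin 4) :=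
  graphOfEdges 4 [(0, 1), (0, 2), (0, 3)]

/-- A 3-star with one 3-star appended onto a leaf. -/
def exTree1 : SimpleGraph (Fin 7) :=
  graphOfEdges 7 [(0, 1), (0, 2), (0, 3),
    (1, 4), (4, 5), (4, 6)]

/-- The path `0 - 1 - 2 - 3` with one 3-star appended onto its end vertex `3`. -/
def exTree2 : SimpleGraph (Fin 7) :=
  graphOfEdges 7 [(0, 1), (1, 2), (2, 3),
    (3, 4), (4, 5), (4, 6)]

/-- The path `0 - 1 - 2 - 3` with two 3-stars appended onto its end vertex `3`. -/
def exTree3 : SimpleGraph (Fin 10) :=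
  graphOfEdges 10 [(0, 1), (1, 2), (2, 3),
    (3, 4), (4, 5), (4, 6),
    (3, 7), (7, 8), (7, 9)]

/-- A 3-star with 3-stars appended onto its leaves: 2, 0, 0 of them. -/
def exTree4 : SimpleGraph (Fin 10) :=
  graphOfEdges 10 [(0, 1), (0, 2), (0, 3),
    (1, 4), (4, 5), (4, 6),
    (1, 7), (7, 8), (7, 9)]

/-- A 3-star with 3-stars appended onto its leaves: 1, 1, 0 of them. -/
def exTree5 : SimpleGraph (Fin 10) :=
  graphOfEdges 10 [(0, 1), (0, 2), (0, 3),
    (1, 4), (4, 5), (4, 6),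
    (2, 7), (7, 8), (7, 9)]

/-- A 3-star with 3-stars appended onto its leaves: 1, 1, 1 of them. -/
def exTree6 : SimpleGraph (Fin 13) :=
  graphOfEdges 13 [(0, 1), (0, 2), (0, 3),
    (1, 4), (4, 5), (4, 6),
    (2, 7), (7, 8), (7, 9),
    (3, 10), (10, 11), (10, 12)]

/-- A 3-star with 3-stars appended onto its leaves: 2, 1, 0 of them. -/
def exTree7 : SimpleGraph (Fin 13) :=
  graphOfEdges 13 [(0, 1), (0, 2), (0, 3),
    (1, 4), (4, 5), (4, 6),
    (1, 7), (7, 8), (7, 9),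
    (2, 10), (10, 11), (10, 12)]

/-- A 3-star with 3-stars appended onto its leaves: 2, 1, 1 of them. -/
def exTree8 : SimpleGraph (Fin 16) :=
  graphOfEdges 16 [(0, 1), (0, 2), (0, 3),
    (1, 4), (4, 5), (4, 6),
    (1, 7), (7, 8), (7, 9),
    (2, 10), (10, 11), (10, 12),
    (3, 13), (13, 14), (13, 15)]

/-- A 3-star with 3-stars appended onto its leaves: 2, 2, 0 of them. -/
def exTree9 : SimpleGraph (Fin 16) :=
  graphOfEdges 16 [(0, 1), (0, 2), (0, 3),
    (1, 4), (4, 5), (4, 6),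
    (1, 7), (7, 8), (7, 9),
    (2, 10), (10, 11), (10, 12),
    (2, 13), (13, 14), (13, 15)]

/-- A 3-star with 3-stars appended onto its leaves: 2, 2, 1 of them. -/
def exTree10 : SimpleGraph (Fin 19) :=
  graphOfEdges 19 [(0, 1), (0, 2), (0, 3),
    (1, 4), (4, 5), (4, 6),
    (1, 7), (7, 8), (7, 9),
    (2, 10), (10, 11), (10, 12),
    (2, 13), (13, 14), (13, 15),
    (3, 16), (16, 17), (16, 18)]

/-- A 3-star with 3-stars appended onto its leaves: 2, 2, 2 of them. -/
def exTree11 : SimpleGraph (Fin 22) :=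
  graphOfEdges 22 [(0, 1), (0, 2), (0, 3),
    (1, 4), (4, 5), (4, 6),
    (1, 7), (7, 8), (7, 9),
    (2, 10), (10, 11), (10, 12),
    (2, 13), (13, 14), (13, 15),
    (3, 16), (16, 17), (16, 18),
    (3, 19), (19, 20), (19, 21)]

/-- The collection `𝒯_Δ`: the twelve trees above for `Δ = 3`, and only the star `K_{1,Δ}`
for `Δ ≥ 4` (values of `Δ` below `3` are irrelevant). -/
def exceptionalTrees (Δ : ℕ) : Set (Σ V : Type, SimpleGraph V) :=
  if Δ = 3 then
    {⟨_, exTree0⟩, ⟨_, exTree1⟩, ⟨_, exTree2⟩, ⟨_, exTree3⟩, ⟨_, exTree4⟩, ⟨_, exTree5⟩,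
      ⟨_, exTree6⟩, ⟨_, exTree7⟩, ⟨_, exTree8⟩, ⟨_, exTree9⟩, ⟨_, exTree10⟩, ⟨_, exTree11⟩}
  else
    {⟨_, completeBipartiteGraph (Fin 1) (Fin Δ)⟩}

/-- `G` is isomorphic to a tree in `𝒯_Δ`. -/
def IsExceptional {V : Type*} (Δ : ℕ) (G : SimpleGraph V) : Prop :=
  ∃ T ∈ exceptionalTrees Δ, Nonempty (G ≃g T.2)

/-! The argument works with the complement `S` of a code and bounds the largest possible size `m` of
`S`. The theorem says that `m ≥ n / Δ`, except that the largest `m` equals `(n - 1) / Δ` for the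
exceptional trees.

In an acyclic graph, separation is only an issue for pairs at distance at most two, so being the
complement of a code is a local condition (`isIdentifyingCode_iff`). Every finite rooted tree is
built from single vertices by joining two rooted trees with an edge between their roots and keeping
the first root. When this is done, all conditions not involving the root can be settled, and what
later joins need to know about `S` fits into five bits, a `RootState`. `validOffRoot_join` and the
lemmas on the four predicates say exactly how these bits combine and which combinations are
forbidden.

For the bound, a rooted tree is assigned to a class, given by a few pairs (state, lower bound for `Δ
* m - size`) that are realized by suitable sets `S`. A point in `S` contributes `Δ - 1` to this
surplus and a point outside contributes `-1`. Forgetting excess surplus leaves finite tables closed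
under joining, `smallClasses` for `Δ = 3` and `largeClasses` for all `Δ ≥ 4` at once; closure is a
finite check. In the second table the bounds are linear in `D = Δ - 4` and in the number `Δ - 1 -
kids` of further children the root may get. The latter is needed because a star rooted at its
centre, with at least three leaves, gains just this amount by missing one leaf. Some classes also
record the shape of the tree, so that whatever fails the bound is known up to isomorphism.

Finally the tree is rooted at a leaf, hence is `pt.join t`, and each class of `t` either yields a
code missing at least `n / Δ` vertices or names an exceptional tree or a path on two or four
vertices, which maximum degree at least three excludes. The exact value is found by dynamic
programming over states (`maxTable`) for the twelve trees and directly for stars. -/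

/-- Two rooted graphs joined by an edge between their roots. -/
def joinRoots {A B : Type*} (G : SimpleGraph A) (H : SimpleGraph B) (a : A) (b : B) :
    SimpleGraph (A ⊕ B) where
  Adj
    | .inl x, .inl y => G.Adj x y
    | .inr x, .inr y => H.Adj x y
    | .inl x, .inr y => x = a ∧ y = b
    | .inr y, .inl x => x = a ∧ y = b
  symm := ⟨by rintro (x | x) (y | y) h <;> first | exact h.symm | exact h⟩
  loopless := ⟨by rintro (x | x) h <;> simp at h⟩

section joinRoots
variable {A B : Type*} (G : SimpleGraph A) (H : SimpleGraph B) (a : A) (b : B)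

@[simp] theorem joinRoots_inl_inl (x y : A) :
    (joinRoots G H a b).Adj (.inl x) (.inl y) ↔ G.Adj x y := Iff.rfl
@[simp] theorem joinRoots_inr_inr (x y : B) :
    (joinRoots G H a b).Adj (.inr x) (.inr y) ↔ H.Adj x y := Iff.rfl
@[simp] theorem joinRoots_inl_inr (x : A) (y : B) :
    (joinRoots G H a b).Adj (.inl x) (.inr y) ↔ x = a ∧ y = b := Iff.rfl
@[simp] theorem joinRoots_inr_inl (x : A) (y : B) :
    (joinRoots G H a b).Adj (.inr y) (.inl x) ↔ x = a ∧ y = b := Iff.rfl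

end joinRoots

/-! ### Conditions on the set of missed vertices, seen from the root -/

section rooted
variable {V : Type*} (G : SimpleGraph V) (r : V) (S : V → Prop)

/-- Every neighbour of the root is in `S`. -/
def Enclosed : Prop := ∀ w, G.Adj r w → S w

/-- Some neighbour of the root lies in `S` together with all its neighbours other than the root. -/
def HasDeepChild : Prop := ∃ x, G.Adj r x ∧ S x ∧ ∀ w, G.Adj x w → w ≠ r → S w

/-- The root and one of its neighbours are not separated by the complement of `S`. -/
def HasCloseTwin : Prop :=
  ∃ x, G.Adj r x ∧ (∀ w, G.Adj r w → w ≠ x → S w) ∧ ∀ w, G.Adj x w → w ≠ r → S w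

/-- The root and a vertex at distance two from it are not separated by the complement of `S`. -/
def HasFarTwin : Prop :=
  S r ∧ ∃ y, G.Adj r y ∧ (∃ x, G.Adj y x ∧ x ≠ r ∧ S x ∧ ∀ w, G.Adj x w → w ≠ y → S w) ∧
    ∀ w, G.Adj r w → w ≠ y → S w

/-- The complement of `S` satisfies all those conditions for being an identifying code
that do not involve the root as one of the vertices to be dominated or separated. -/
structure ValidOffRoot : Prop where
  dom : ∀ v, v ≠ r → S v → ∃ w, G.Adj v w ∧ ¬ S w
  sep_adj : ∀ u v, u ≠ r → v ≠ r → G.Adj u v →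
    ∃ w, ¬ S w ∧ w ≠ u ∧ w ≠ v ∧ (G.Adj u w ∨ G.Adj v w)
  sep_two : ∀ c u v, u ≠ r → v ≠ r → u ≠ v → G.Adj c u → G.Adj c v → S u → S v →
    ∃ w, ¬ S w ∧ w ≠ c ∧ (G.Adj u w ∨ G.Adj v w)

end rooted

/-! ### How the conditions behave under joining -/

section join
variable {A B : Type*} {G : SimpleGraph A} {H : SimpleGraph B} {a : A} {b : B} {S : A ⊕ B → Prop}

theorem enclosed_join : Enclosed (joinRoots G H a b) (.inl a) S ↔
    Enclosed G a (S ∘ .inl) ∧ S (.inr b) := by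
  simp [Enclosed]

theorem hasDeepChild_join : HasDeepChild (joinRoots G H a b) (.inl a) S ↔
    HasDeepChild G a (S ∘ .inl) ∨ (S (.inr b) ∧ Enclosed H b (S ∘ .inr)) := by
  simp only [HasDeepChild, Enclosed, Sum.exists, Sum.forall]
  simp
  grind [SimpleGraph.Adj.ne']

theorem hasCloseTwin_join : HasCloseTwin (joinRoots G H a b) (.inl a) S ↔
    (HasCloseTwin G a (S ∘ .inl) ∧ S (.inr b)) ∨
      (Enclosed H b (S ∘ .inr) ∧ Enclosed G a (S ∘ .inl)) := by
  simp only [HasCloseTwin, Enclosed, Sum.exists, Sum.forall]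
  simp
  grind [SimpleGraph.Adj.ne']

theorem hasFarTwin_join : HasFarTwin (joinRoots G H a b) (.inl a) S ↔
    (HasFarTwin G a (S ∘ .inl) ∧ S (.inr b)) ∨
      (S (.inl a) ∧ HasDeepChild H b (S ∘ .inr) ∧ Enclosed G a (S ∘ .inl)) := by
  simp only [HasFarTwin, HasDeepChild, Enclosed, Sum.exists, Sum.forall]
  simp
  grind [SimpleGraph.Adj.ne']

/-- The root `b` of the lower tree stops being exempt here; its only new neighbour is `a`, which
dominates it unless `a` is in `S`. The next two lemmas settle the pairs involving `b` in the same
way. -/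
theorem dom_join :
    (∀ v, v ≠ .inl a → S v → ∃ w, (joinRoots G H a b).Adj v w ∧ ¬ S w) ↔
      (∀ v, v ≠ a → S (.inl v) → ∃ w, G.Adj v w ∧ ¬ S (.inl w)) ∧
      (∀ v, v ≠ b → S (.inr v) → ∃ w, H.Adj v w ∧ ¬ S (.inr w)) ∧
      (S (.inl a) → ¬ (S (.inr b) ∧ Enclosed H b (S ∘ .inr))) := by
  simp only [Enclosed, Sum.exists, Sum.forall]
  simp
  grind

theorem sep_adj_join :
    (∀ u v, u ≠ .inl a → v ≠ .inl a → (joinRoots G H a b).Adj u v →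
      ∃ w, ¬ S w ∧ w ≠ u ∧ w ≠ v ∧
        ((joinRoots G H a b).Adj u w ∨ (joinRoots G H a b).Adj v w)) ↔
      (∀ u v, u ≠ a → v ≠ a → G.Adj u v →
        ∃ w, ¬ S (.inl w) ∧ w ≠ u ∧ w ≠ v ∧ (G.Adj u w ∨ G.Adj v w)) ∧
      (∀ u v, u ≠ b → v ≠ b → H.Adj u v →
        ∃ w, ¬ S (.inr w) ∧ w ≠ u ∧ w ≠ v ∧ (H.Adj u w ∨ H.Adj v w)) ∧
      (S (.inl a) → ¬ HasCloseTwin H b (S ∘ .inr)) := by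
  constructor
  · intro h
    refine ⟨fun u v hu hv huv => ?_, fun u v hu hv huv => ?_, fun ha ⟨x, hx, h1, h2⟩ => ?_⟩
    · obtain ⟨w | w, hw⟩ := h (.inl u) (.inl v) (by simpa) (by simpa) huv <;> simp at hw <;> grind
    · obtain ⟨w | w, hw⟩ := h (.inr u) (.inr v) (by simp) (by simp) huv <;> simp at hw <;> grind
    · obtain ⟨w | w, hw⟩ := h (.inr b) (.inr x) (by simp) (by simp) hx <;> simp at hw <;> grind
  · rintro ⟨hG, hH, hab⟩ (u | u) (v | v) hu hv huv
    · obtain ⟨w, hw⟩ := hG u v (by simpa using hu) (by simpa using hv) huv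
      exact ⟨.inl w, by simpa using hw⟩
    · simp at huv; grind
    · simp at huv; grind
    · by_cases ha : S (.inl a)
      · have hab := hab ha
        simp only [HasCloseTwin, Function.comp, not_exists, not_and, not_forall] at hab
        by_cases hub : u = b
        · subst hub
          have := hab v huv
          by_cases h1 : ∀ w, H.Adj u w → w ≠ v → S (.inr w)
          · obtain ⟨w, h2, h3, h4⟩ := this h1
            exact ⟨.inr w, by simp; grind [huv.ne, h2.ne]⟩
          · push Not at h1
            obtain ⟨w, h2, h3, h4⟩ := h1
            exact ⟨.inr w, by simp; grind [huv.ne, h2.ne]⟩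
        · by_cases hvb : v = b
          · subst hvb
            have := hab u huv.symm
            by_cases h1 : ∀ w, H.Adj v w → w ≠ u → S (.inr w)
            · obtain ⟨w, h2, h3, h4⟩ := this h1
              exact ⟨.inr w, by simp; grind [huv.ne, h2.ne]⟩
            · push Not at h1
              obtain ⟨w, h2, h3, h4⟩ := h1
              exact ⟨.inr w, by simp; grind [huv.ne, h2.ne]⟩
          · obtain ⟨w, hw⟩ := hH u v hub hvb huv
            exact ⟨.inr w, by simpa using hw⟩
      · by_cases hub : u = b
        · exact ⟨.inl a, by simpa [hub]⟩
        · by_cases hvb : v = b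
          · exact ⟨.inl a, by simpa [hvb]⟩
          · obtain ⟨w, hw⟩ := hH u v hub hvb huv
            exact ⟨.inr w, by simpa using hw⟩

theorem sep_two_join :
    (∀ c u v, u ≠ .inl a → v ≠ .inl a → u ≠ v → (joinRoots G H a b).Adj c u →
      (joinRoots G H a b).Adj c v → S u → S v →
      ∃ w, ¬ S w ∧ w ≠ c ∧ ((joinRoots G H a b).Adj u w ∨ (joinRoots G H a b).Adj v w)) ↔
      (∀ c u v, u ≠ a → v ≠ a → u ≠ v → G.Adj c u → G.Adj c v → S (.inl u) → S (.inl v) →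
        ∃ w, ¬ S (.inl w) ∧ w ≠ c ∧ (G.Adj u w ∨ G.Adj v w)) ∧
      (∀ c u v, u ≠ b → v ≠ b → u ≠ v → H.Adj c u → H.Adj c v → S (.inr u) → S (.inr v) →
        ∃ w, ¬ S (.inr w) ∧ w ≠ c ∧ (H.Adj u w ∨ H.Adj v w)) ∧
      (S (.inl a) → ¬ HasFarTwin H b (S ∘ .inr)) ∧
      ¬ ((S (.inr b) ∧ Enclosed H b (S ∘ .inr)) ∧ HasDeepChild G a (S ∘ .inl)) := by
  constructor
  · intro h
    refine ⟨fun c u v hu hv huv hcu hcv Su Sv => ?_, fun c u v hu hv huv hcu hcv Su Sv => ?_,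
      fun ha ⟨hb, y, hy, ⟨x, hyx, hxb, hx, h1⟩, h2⟩ => ?_,
      fun ⟨⟨hb, hz⟩, x, hx, Sx, h1⟩ => ?_⟩
    · obtain ⟨w | w, hw⟩ := h (.inl c) (.inl u) (.inl v) (by simpa) (by simpa) (by simpa)
        hcu hcv Su Sv <;> simp at hw <;> grind
    · obtain ⟨w | w, hw⟩ := h (.inr c) (.inr u) (.inr v) (by simp) (by simp) (by simpa)
        hcu hcv Su Sv <;> simp at hw <;> grind
    · obtain ⟨w | w, hw⟩ := h (.inr y) (.inr x) (.inr b) (by simp) (by simp) (by simpa)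
        hyx hy.symm hx hb <;> simp at hw <;> grind
    · obtain ⟨w | w, hw⟩ := h (.inl a) (.inl x) (.inr b) (by simpa using hx.ne') (by simp) (by simp)
        hx (by simp) Sx hb <;> simp at hw <;> grind [Enclosed]
  · rintro ⟨hG, hH, hab, hba⟩ c u v hu hv huv hcu hcv Su Sv
    -- The new pairs at distance two across the edge: `b` and another neighbour `x` of `a`. Their
    -- common neighbour `a` cannot separate them, whether or not it lies in `S`.
    have key : ∀ x : A, G.Adj a x → S (.inl x) → S (.inr b) →
        (∃ w, ¬ S (.inl w) ∧ G.Adj x w ∧ w ≠ a) ∨ (∃ w, ¬ S (.inr w) ∧ H.Adj b w) := by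
      intro x hx Sx Sb
      by_contra! hcon
      exact hba ⟨⟨Sb, fun w hw => by_contra fun h => hcon.2 w h hw⟩, x, hx, Sx,
        fun w hw hwa => by_contra fun h => hwa (hcon.1 w h hw)⟩
    -- The pairs at distance two inside the lower tree that involve its root `b`. Only they can
    -- profit from `a`, so the case that `a` lies in `S` is the one to be treated.
    have key' : ∀ c x : B, H.Adj c x → H.Adj c b → x ≠ b → S (.inr x) → S (.inr b) → S (.inl a) →
        ∃ w, ¬ S (.inr w) ∧ w ≠ c ∧ (H.Adj x w ∨ H.Adj b w) := by
      intro c x hx hcb hxb Sx Sb Sa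
      by_contra! hcon
      refine hab Sa ⟨Sb, c, hcb.symm, ⟨x, hx, hxb, Sx, fun w hw hwc => ?_⟩, fun w hw hwc => ?_⟩
      · exact by_contra fun h => (hcon w h hwc).1 hw
      · exact by_contra fun h => (hcon w h hwc).2 hw
    rcases c with c | c <;> rcases u with u | u <;> rcases v with v | v
    · obtain ⟨w, hw⟩ := hG c u v (by simpa using hu) (by simpa using hv) (by simpa using huv)
        hcu hcv Su Sv
      exact ⟨.inl w, by simpa using hw⟩
    · obtain ⟨rfl, rfl⟩ := hcv
      obtain ⟨w, h1, h2, h3⟩ | ⟨w, h1, h2⟩ := key u hcu Su Sv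
      · exact ⟨.inl w, by simp [*]⟩
      · exact ⟨.inr w, by simp [*]⟩
    · obtain ⟨rfl, rfl⟩ := hcu
      obtain ⟨w, h1, h2, h3⟩ | ⟨w, h1, h2⟩ := key v hcv Sv Su
      · exact ⟨.inl w, by simp [*]⟩
      · exact ⟨.inr w, by simp [*]⟩
    · simp at hcu hcv; grind
    · simp at hcu hcv hu hv; grind
    · simp at hcu hcv hu hv; grind
    · simp at hcu hcv hu hv; grind
    · replace huv : u ≠ v := by simpa using huv
      by_cases hub : u = b
      · subst hub
        by_cases ha : S (.inl a)
        · obtain ⟨w, h1, h2, h3⟩ := key' c v hcv hcu huv.symm Sv Su ha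
          exact ⟨.inr w, by simpa [h1, h2] using h3.symm⟩
        · exact ⟨.inl a, by simpa⟩
      · by_cases hvb : v = b
        · subst hvb
          by_cases ha : S (.inl a)
          · obtain ⟨w, h1, h2, h3⟩ := key' c u hcu hcv hub Su Sv ha
            exact ⟨.inr w, by simpa [h1, h2] using h3⟩
          · exact ⟨.inl a, by simpa⟩
        · obtain ⟨w, hw⟩ := hH c u v hub hvb huv hcu hcv Su Sv
          exact ⟨.inr w, by simpa using hw⟩

/-- The right-hand side depends on the two parts only through their validity and the five bits of a
`RootState`. This is what makes the whole problem a computation with finitely many states. -/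
theorem validOffRoot_join : ValidOffRoot (joinRoots G H a b) (.inl a) S ↔
    ValidOffRoot G a (S ∘ .inl) ∧ ValidOffRoot H b (S ∘ .inr) ∧
      (S (.inl a) → ¬ (S (.inr b) ∧ Enclosed H b (S ∘ .inr)) ∧ ¬ HasCloseTwin H b (S ∘ .inr) ∧
        ¬ HasFarTwin H b (S ∘ .inr)) ∧
      ¬ ((S (.inr b) ∧ Enclosed H b (S ∘ .inr)) ∧ HasDeepChild G a (S ∘ .inl)) := by
  constructor
  · rintro ⟨h1, h2, h3⟩
    obtain ⟨g1, h1, j1⟩ := dom_join.1 h1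
    obtain ⟨g2, h2, j2⟩ := sep_adj_join.1 h2
    obtain ⟨g3, h3, j3, k3⟩ := sep_two_join.1 h3
    exact ⟨⟨g1, g2, g3⟩, ⟨h1, h2, h3⟩, fun h => ⟨j1 h, j2 h, j3 h⟩, k3⟩
  · rintro ⟨⟨g1, g2, g3⟩, ⟨h1, h2, h3⟩, j, k⟩
    exact ⟨dom_join.2 ⟨g1, h1, fun h => (j h).1⟩, sep_adj_join.2 ⟨g2, h2, fun h => (j h).2.1⟩,
      sep_two_join.2 ⟨g3, h3, fun h => (j h).2.2, k⟩⟩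
end join

/-! ### Identifying codes of acyclic graphs as a local condition -/

section code
variable {V : Type*} {G : SimpleGraph V}

/-- Hanging the graph below an extra vertex that lies in `S` removes the exemption of `r`, while the
extra vertex neither dominates nor separates anything. Validity at the root thus becomes an instance
of `validOffRoot_join`. -/
theorem validOffRoot_join_outer (r : V) (S : V → Prop) :
    ValidOffRoot (joinRoots (⊥ : SimpleGraph Unit) G () r) (.inl ()) (Sum.elim (fun _ => True) S) ↔
      (∀ v, S v → ∃ w, G.Adj v w ∧ ¬ S w) ∧
      (∀ u v, G.Adj u v → ∃ w, ¬ S w ∧ w ≠ u ∧ w ≠ v ∧ (G.Adj u w ∨ G.Adj v w)) ∧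
      (∀ c u v, u ≠ v → G.Adj c u → G.Adj c v → S u → S v →
        ∃ w, ¬ S w ∧ w ≠ c ∧ (G.Adj u w ∨ G.Adj v w)) := by
  constructor
  · rintro ⟨h1, h2, h3⟩
    refine ⟨fun v hv => ?_, fun u v huv => ?_, fun c u v huv hcu hcv Su Sv => ?_⟩
    · simpa using h1 (.inr v) (by simp) hv
    · simpa using h2 (.inr u) (.inr v) (by simp) (by simp) huv
    · simpa using h3 (.inr c) (.inr u) (.inr v) (by simp) (by simp) (by simpa) hcu hcv Su Sv
  · rintro ⟨h1, h2, h3⟩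
    refine ⟨?_, ?_, ?_⟩
    · rintro (v | v) hv Sv
      · simp at hv
      · simpa using h1 v Sv
    · rintro (u | u) (v | v) hu hv huv
      · simp at hu
      · simp at hu
      · simp at hv
      · simpa using h2 u v huv
    · rintro (c | c) (u | u) (v | v) hu hv huv hcu hcv Su Sv
      · simp at hu
      · simp at hu
      · simp at hv
      · simp at hcu hcv huv; grind
      · simp at hu
      · simp at hu
      · simp at hv
      · simpa using h3 c u v (by simpa using huv) hcu hcv Su Sv

theorem SimpleGraph.IsAcyclic.not_triangle (hG : G.IsAcyclic) {u v w : V} (huv : G.Adj u v)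
    (huw : G.Adj u w) (hvw : G.Adj v w) : False := by
  classical
  exact hG.cliqueFree le_rfl {u, v, w} (SimpleGraph.is3Clique_triple_iff.2 ⟨huv, huw, hvw⟩)

theorem SimpleGraph.IsAcyclic.eq_of_common_neighbors (hG : G.IsAcyclic) {u v c w : V} (huv : u ≠ v)
    (huc : G.Adj u c) (hcv : G.Adj c v) (huw : G.Adj u w) (hwv : G.Adj w v) : c = w := by
  have p (x : V) (h1 : G.Adj u x) (h2 : G.Adj x v) :
      (SimpleGraph.Walk.cons h1 (SimpleGraph.Walk.cons h2 .nil)).IsPath := by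
    simp [SimpleGraph.Walk.cons_isPath_iff, h1.ne, h2.ne, huv]
  have := (hG.subsingleton_path u v).elim ⟨_, p c huc hcv⟩ ⟨_, p w huw hwv⟩
  simp at this
  exact this.1

/-- In an acyclic graph only pairs of vertices at distance at most two need to be separated. -/
theorem isIdentifyingCode_iff (hG : G.IsAcyclic) (C : Finset V) :
    IsIdentifyingCode G C ↔
      (∀ v, v ∉ C → ∃ w, G.Adj v w ∧ ¬ w ∉ C) ∧
      (∀ u v, G.Adj u v → ∃ w, ¬ w ∉ C ∧ w ≠ u ∧ w ≠ v ∧ (G.Adj u w ∨ G.Adj v w)) ∧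
      (∀ c u v, u ≠ v → G.Adj c u → G.Adj c v → u ∉ C → v ∉ C →
        ∃ w, ¬ w ∉ C ∧ w ≠ c ∧ (G.Adj u w ∨ G.Adj v w)) := by
  simp only [not_not]
  constructor
  · rintro ⟨hd, hs⟩
    refine ⟨fun v hv => ?_, fun u v huv => ?_, fun c u v huv hcu hcv hu hv => ?_⟩
    · obtain h | ⟨w, hw, h⟩ := hd v
      · exact absurd h hv
      · exact ⟨w, h, hw⟩
    · obtain ⟨w, hw, h⟩ := hs u v huv.ne
      simp only [Xor, closedNbhd, Set.mem_ofPred_eq] at h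
      refine ⟨w, hw, ?_⟩
      grind [huv.symm]
    · obtain ⟨w, hw, h⟩ := hs u v huv
      simp only [Xor, closedNbhd, Set.mem_ofPred_eq] at h
      refine ⟨w, hw, ?_⟩
      grind [hcu.symm, hcv.symm]
  · rintro ⟨h1, h2, h3⟩
    refine ⟨fun v => ?_, fun u v huv => ?_⟩
    · by_cases hv : v ∈ C
      · exact .inl hv
      · obtain ⟨w, hw, h⟩ := h1 v hv
        exact .inr ⟨w, h, hw⟩
    · simp only [Xor, closedNbhd, Set.mem_ofPred_eq]
      by_cases hadj : G.Adj u v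
      · obtain ⟨w, hw, hwu, hwv, h⟩ := h2 u v hadj
        -- No vertex sees both ends of an edge, so a third vertex of the code seen by one end
        -- separates them.
        have : ¬ (G.Adj u w ∧ G.Adj v w) := fun h => hG.not_triangle hadj h.1 h.2
        exact ⟨w, hw, by tauto⟩
      · have hadj' : ¬ G.Adj v u := fun h => hadj h.symm
        by_cases hu : u ∈ C
        · exact ⟨u, hu, by simp [huv, hadj']⟩
        by_cases hv : v ∈ C
        · exact ⟨v, hv, by simp [huv.symm, hadj]⟩
        by_cases hc : ∃ c, G.Adj c u ∧ G.Adj c v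
        · obtain ⟨c, hcu, hcv⟩ := hc
          obtain ⟨w, hw, hwc, h⟩ := h3 c u v huv hcu hcv hu hv
          have : ¬ (G.Adj u w ∧ G.Adj v w) := fun h =>
            hwc (hG.eq_of_common_neighbors huv hcu.symm hcv h.1 h.2.symm).symm
          have hwu : w ≠ u := fun h => hu (h ▸ hw)
          have hwv : w ≠ v := fun h => hv (h ▸ hw)
          exact ⟨w, hw, by tauto⟩
        -- At distance at least three the closed neighbourhoods are disjoint, and any vertex
        -- dominating `u` separates.
        · obtain ⟨w, hw, h⟩ := h1 u hu
          refine ⟨w, h, .inl ⟨.inr hw, ?_⟩⟩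
          rintro (rfl | h')
          · exact hv h
          · exact hc ⟨w, hw.symm, h'.symm⟩

theorem isIdentifyingCode_iff_rooted (hG : G.IsAcyclic) (r : V) (C : Finset V) :
    IsIdentifyingCode G C ↔ ValidOffRoot G r (· ∉ C) ∧
      ¬ (r ∉ C ∧ Enclosed G r (· ∉ C)) ∧ ¬ HasCloseTwin G r (· ∉ C) ∧
        ¬ HasFarTwin G r (· ∉ C) := by
  rw [isIdentifyingCode_iff hG, ← validOffRoot_join_outer r (· ∉ C), validOffRoot_join]
  have h1 : ValidOffRoot (⊥ : SimpleGraph Unit) () (fun _ => True) :=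
    ⟨by simp, by simp, by simp⟩
  have h2 : (Sum.elim (fun _ : Unit => True) (· ∉ C)) ∘ .inr = (· ∉ C) := rfl
  have h3 : ¬ HasDeepChild (⊥ : SimpleGraph Unit) () (fun _ => True) := by simp [HasDeepChild]
  simp [h1, h2, h3]

end code

/-! ### Rooted trees as terms -/

/-- Finite rooted ordered trees: a single vertex, or a rooted tree `t` to whose root the root of
another tree `s` is added as a further child. -/
inductive JoinTree
  | pt : JoinTree
  | join (t s : JoinTree) : JoinTree
  deriving DecidableEq

namespace JoinTree

def Vert : JoinTree → Type
  | pt => Unit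
  | join t s => t.Vert ⊕ s.Vert

def root : (t : JoinTree) → t.Vert
  | pt => ()
  | join t _ => .inl t.root

def graph : (t : JoinTree) → SimpleGraph t.Vert
  | pt => ⊥
  | join t s => joinRoots t.graph s.graph t.root s.root

instance instFintypeVert : (t : JoinTree) → Fintype t.Vert
  | pt => inferInstanceAs (Fintype Unit)
  | join t s =>
    have := instFintypeVert t
    have := instFintypeVert s
    inferInstanceAs (Fintype (t.Vert ⊕ s.Vert))

instance instDecidableEqVert : (t : JoinTree) → DecidableEq t.Vert
  | pt => inferInstanceAs (DecidableEq Unit)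
  | join t s =>
    have := instDecidableEqVert t
    have := instDecidableEqVert s
    inferInstanceAs (DecidableEq (t.Vert ⊕ s.Vert))

/-- The number of vertices. -/
def size : JoinTree → ℕ
  | pt => 1
  | join t s => t.size + s.size

/-- The number of children of the root. -/
def kids : JoinTree → ℕ
  | pt => 0
  | join t _ => t.kids + 1

theorem card_vert : (t : JoinTree) → Fintype.card t.Vert = t.size
  | pt => rfl
  | join t s => by
    change Fintype.card (t.Vert ⊕ s.Vert) = t.size + s.size
    rw [Fintype.card_sum, card_vert t, card_vert s]

end JoinTree

/-! ### Root states and their composition -/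

/-- What a vertex set in a rooted tree looks like near the root: whether it contains the root, and
whether `Enclosed`, `HasDeepChild`, `HasCloseTwin`, `HasFarTwin` hold. -/
structure RootState where
  mem : Bool
  enclosed : Bool
  deep : Bool
  close : Bool
  far : Bool
  deriving DecidableEq

namespace RootState

/-- Joining sets with these states creates a violation. -/
def clash (a b : RootState) : Bool :=
  (a.mem && ((b.mem && b.enclosed) || b.close || b.far)) || (b.mem && b.enclosed && a.deep)

/-- The state of the union of two sets when trees are joined. -/
def merge (a b : RootState) : RootState where
  mem := a.mem
  enclosed := a.enclosed && b.mem
  deep := a.deep || (b.mem && b.enclosed)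
  close := (a.close && b.mem) || (b.enclosed && a.enclosed)
  far := (a.far && b.mem) || (a.mem && b.deep && a.enclosed)

/-- The set is valid at the root as well. -/
def isFinal (a : RootState) : Bool := !((a.mem && a.enclosed) || a.close || a.far)

/-- The set `S` is valid off the root, and in state `a` or a more favourable one. -/
structure Bounds {V : Type*} (G : SimpleGraph V) (r : V) (S : V → Prop) (a : RootState) : Prop where
  valid : ValidOffRoot G r S
  mem : S r ↔ a.mem
  enclosed : Enclosed G r S → a.enclosed
  deep : HasDeepChild G r S → a.deep
  close : HasCloseTwin G r S → a.close
  far : HasFarTwin G r S → a.far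

/-- The set `S` is valid off the root, and in state `a`. -/
structure Describes {V : Type*} (G : SimpleGraph V) (r : V) (S : V → Prop) (a : RootState) :
    Prop where
  valid : ValidOffRoot G r S
  mem : S r ↔ a.mem
  enclosed : Enclosed G r S ↔ a.enclosed
  deep : HasDeepChild G r S ↔ a.deep
  close : HasCloseTwin G r S ↔ a.close
  far : HasFarTwin G r S ↔ a.far

theorem exists_describes {V : Type*} {G : SimpleGraph V} {r : V} {S : V → Prop}
    (h : ValidOffRoot G r S) : ∃ a, Describes G r S a := by
  classical
  exact ⟨⟨decide (S r), decide (Enclosed G r S), decide (HasDeepChild G r S),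
    decide (HasCloseTwin G r S), decide (HasFarTwin G r S)⟩,
    h, by simp, by simp, by simp, by simp, by simp⟩

section
variable {A B : Type*} {G : SimpleGraph A} {H : SimpleGraph B} {a : A} {b : B} {S : A ⊕ B → Prop}
  {x y : RootState}

/-- One-sided information is enough for constructing codes: `clash` and `merge` are monotone in the
bits, so overestimating a bit can only forbid more. -/
theorem Bounds.join (hx : Bounds G a (S ∘ .inl) x) (hy : Bounds H b (S ∘ .inr) y)
    (hc : x.clash y = false) : Bounds (joinRoots G H a b) (.inl a) S (x.merge y) := by
  obtain ⟨hx, x1, x2, x3, x4, x5⟩ := hx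
  obtain ⟨hy, y1, y2, y3, y4, y5⟩ := hy
  unfold RootState.clash at hc
  unfold RootState.merge
  simp only [Function.comp_apply] at x1 y1
  refine ⟨validOffRoot_join.2 ⟨hx, hy, ?_, ?_⟩, x1, ?_, ?_, ?_, ?_⟩
  · simp at hc; grind
  · simp at hc; grind
  · rw [enclosed_join]
    rintro ⟨h, h'⟩
    simp [x2 h, y1.1 h']
  · rw [hasDeepChild_join]
    rintro (h | ⟨h, h'⟩)
    · simp [x3 h]
    · simp [y1.1 h, y2 h']
  · rw [hasCloseTwin_join]
    rintro (⟨h, h'⟩ | ⟨h, h'⟩)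
    · simp [x4 h, y1.1 h']
    · simp [y2 h, x2 h']
  · rw [hasFarTwin_join]
    rintro (⟨h, h'⟩ | ⟨h, h', h''⟩)
    · simp [x5 h, y1.1 h']
    · simp [x1.1 h, y3 h', x2 h'']

/-- The converse direction, with exact states: every valid set on the join arises from valid sets on
the parts. It serves the upper bounds on the number of missed vertices. -/
theorem Describes.join (hS : ValidOffRoot (joinRoots G H a b) (.inl a) S) :
    ∃ x y, Describes G a (S ∘ .inl) x ∧ Describes H b (S ∘ .inr) y ∧
      Describes (joinRoots G H a b) (.inl a) S (x.merge y) ∧ x.clash y = false := by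
  obtain ⟨hx, hy, h1, h2⟩ := validOffRoot_join.1 hS
  obtain ⟨x, hx⟩ := exists_describes hx
  obtain ⟨y, hy⟩ := exists_describes hy
  refine ⟨x, y, hx, hy, ⟨hS, hx.mem, ?_, ?_, ?_, ?_⟩, ?_⟩
  · rw [enclosed_join, hx.enclosed]; simp [merge, ← hy.mem]
  · rw [hasDeepChild_join, hx.deep, hy.enclosed]; simp [merge, ← hy.mem]
  · rw [hasCloseTwin_join, hx.close, hx.enclosed, hy.enclosed]; simp [merge, ← hy.mem]
  · rw [hasFarTwin_join, hx.far, hx.enclosed, hy.deep]; simp [merge, ← hy.mem, ← hx.mem]; tauto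
  · have := hx.mem; have := hx.deep; have := hy.mem; have := hy.enclosed
    have := hy.close; have := hy.far
    simp only [Function.comp_apply] at *
    simp [clash]
    grind
end

end RootState

/-! ### Codes missing a given number of vertices -/

/-- `G` has an identifying code that misses exactly `m` vertices. -/
def HasCodeMissing {V : Type*} [Fintype V] (G : SimpleGraph V) (m : ℕ) : Prop :=
  ∃ C : Finset V, IsIdentifyingCode G C ∧ C.card + m = Fintype.card V

theorem IsIdentifyingCode.map {V W : Type*} {G : SimpleGraph V} {H : SimpleGraph W} (φ : G ≃g H)
    {C : Finset V} (hC : IsIdentifyingCode G C) :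
    IsIdentifyingCode H (C.map φ.toEquiv.toEmbedding) := by
  have key (v : V) (w : W) : φ v ∈ closedNbhd H w ↔ v ∈ closedNbhd G (φ.symm w) := by
    have h1 : φ v = w ↔ v = φ.symm w := ⟨fun h => by simp [← h], fun h => by simp [h]⟩
    have h2 : H.Adj w (φ v) ↔ G.Adj (φ.symm w) v := by rw [← φ.map_adj_iff, φ.apply_symm_apply]
    simp only [closedNbhd, Set.mem_ofPred_eq, h1, h2]
  constructor
  · intro w
    obtain h | ⟨v, hv, h⟩ := hC.1 (φ.symm w)
    · exact .inl (Finset.mem_map.2 ⟨_, h, φ.apply_symm_apply w⟩)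
    · exact .inr ⟨φ v, Finset.mem_map_of_mem _ hv, by simpa using φ.map_adj_iff.2 h⟩
  · intro u w huw
    obtain ⟨v, hv, h⟩ := hC.2 (φ.symm u) (φ.symm w) (by simpa using huw)
    exact ⟨φ v, Finset.mem_map_of_mem _ hv, by rwa [key, key]⟩

theorem HasCodeMissing.map {V W : Type*} [Fintype V] [Fintype W] {G : SimpleGraph V}
    {H : SimpleGraph W} (φ : G ≃g H) {m : ℕ} (h : HasCodeMissing G m) : HasCodeMissing H m := by
  obtain ⟨C, hC, hm⟩ := h
  exact ⟨_, hC.map φ, by rw [Finset.card_map, hm, Fintype.card_congr φ.toEquiv]⟩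

theorem RootState.Describes.unique {V : Type*} {G : SimpleGraph V} {r : V} {S : V → Prop}
    {a b : RootState} (ha : a.Describes G r S) (hb : b.Describes G r S) : a = b := by
  cases a; cases b
  rw [RootState.mk.injEq]
  exact ⟨Bool.eq_iff_iff.2 (ha.mem.symm.trans hb.mem),
    Bool.eq_iff_iff.2 (ha.enclosed.symm.trans hb.enclosed),
    Bool.eq_iff_iff.2 (ha.deep.symm.trans hb.deep),
    Bool.eq_iff_iff.2 (ha.close.symm.trans hb.close),
    Bool.eq_iff_iff.2 (ha.far.symm.trans hb.far)⟩

/-! ### Realizable states and exact maxima by dynamic programming -/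

namespace JoinTree
open RootState

/-- Some set of `m` vertices is valid off the root, in state `a` or a more favourable one. -/
def Realizes (t : JoinTree) (a : RootState) (m : ℕ) : Prop :=
  ∃ S : Finset t.Vert, S.card = m ∧ a.Bounds t.graph t.root (· ∈ S)

theorem realizes_pt_out : pt.Realizes ⟨false, true, false, false, false⟩ 0 := by
  refine ⟨∅, rfl, ⟨?_, ?_, ?_⟩, ?_, ?_, ?_, ?_, ?_⟩ <;>
    simp [HasDeepChild, HasCloseTwin, HasFarTwin, graph]

theorem realizes_pt_in : pt.Realizes ⟨true, true, false, false, false⟩ 1 := by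
  refine ⟨{pt.root}, rfl, ⟨?_, ?_, ?_⟩, ?_, ?_, ?_, ?_, ?_⟩ <;>
    simp [HasDeepChild, HasCloseTwin, HasFarTwin, graph]

theorem Realizes.join {t s : JoinTree} {a b : RootState} {m k : ℕ} (ht : t.Realizes a m)
    (hs : s.Realizes b k) (h : a.clash b = false) :
    (t.join s).Realizes (a.merge b) (m + k) := by
  obtain ⟨S, rfl, hS⟩ := ht
  obtain ⟨T, rfl, hT⟩ := hs
  refine ⟨S.disjSum T, Finset.card_disjSum _ _, ?_⟩
  refine Bounds.join (S := fun x : t.Vert ⊕ s.Vert => x ∈ S.disjSum T) ?_ ?_ h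
  · convert hS using 1
    ext x
    simp
  · convert hT using 1
    ext x
    simp

theorem Realizes.hasCodeMissing {t : JoinTree} {a : RootState} {m : ℕ} (ht : t.Realizes a m)
    (h : a.isFinal = true) (hG : t.graph.IsAcyclic) : HasCodeMissing t.graph m := by
  obtain ⟨S, rfl, hv, h1, h2, h3, h4, h5⟩ := ht
  refine ⟨Sᶜ, ?_, by rw [Finset.card_compl]; have := S.card_le_univ; omega⟩
  rw [isIdentifyingCode_iff_rooted hG t.root]
  simp only [Finset.mem_compl, not_not]
  simp only [isFinal, Bool.not_eq_true', Bool.or_eq_false_iff, Bool.and_eq_false_iff] at h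
  refine ⟨hv, ?_, ?_, ?_⟩ <;> grind

/-- Insert a state and a size into a table of maximum sizes. -/
def insertMax (e : RootState × ℕ) : List (RootState × ℕ) → List (RootState × ℕ)
  | [] => [e]
  | x :: l => bif x.1 == e.1 then (x.1, max x.2 e.2) :: l else x :: insertMax e l

/-- The maximum size of a vertex set valid off the root, for each possible state. -/
def maxTable : JoinTree → List (RootState × ℕ)
  | pt => [(⟨false, true, false, false, false⟩, 0), (⟨true, true, false, false, false⟩, 1)]
  | join t s =>
    ((maxTable t).flatMap fun x => (maxTable s).filterMap fun y =>
      bif x.1.clash y.1 then none else some (x.1.merge y.1, x.2 + y.2)).foldr insertMax []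

theorem exists_mem_insertMax {e : RootState × ℕ} {l : List (RootState × ℕ)} {a : RootState} {m : ℕ}
    (h : e = (a, m) ∨ ∃ k, (a, k) ∈ l ∧ m ≤ k) : ∃ k, (a, k) ∈ insertMax e l ∧ m ≤ k := by
  induction l with
  | nil =>
    obtain rfl | ⟨k, hk, -⟩ := h
    · exact ⟨m, by simp [insertMax]⟩
    · simp at hk
  | cons x l ih =>
    unfold insertMax
    by_cases hx : x.1 = e.1
    · simp only [hx, beq_self_eq_true, cond_true]
      obtain rfl | ⟨k, hk, hmk⟩ := h
      · exact ⟨max x.2 m, by simp⟩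
      · rw [List.mem_cons] at hk
        obtain rfl | hk := hk
        · exact ⟨max k e.2, by simp at hx; simp [hx], by simp [hmk]⟩
        · exact ⟨k, by simp [hk], hmk⟩
    · have : (x.1 == e.1) = false := by simpa using hx
      simp only [this, cond_false]
      obtain h | ⟨k, hk, hmk⟩ := h
      · obtain ⟨k, hk, h⟩ := ih (.inl h)
        exact ⟨k, by simp [hk], h⟩
      · rw [List.mem_cons] at hk
        obtain rfl | hk := hk
        · exact ⟨k, by simp, hmk⟩
        · obtain ⟨k, hk, h⟩ := ih (.inr ⟨k, hk, hmk⟩)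
          exact ⟨k, by simp [hk], h⟩

theorem exists_mem_foldr_insertMax {l : List (RootState × ℕ)} {a : RootState} {m : ℕ}
    (h : (a, m) ∈ l) : ∃ k, (a, k) ∈ l.foldr insertMax [] ∧ m ≤ k := by
  induction l with
  | nil => simp at h
  | cons x l ih =>
    rw [List.mem_cons] at h
    rw [List.foldr_cons]
    exact exists_mem_insertMax (h.imp Eq.symm ih)

/-- A valid set splits into valid sets on the two parts, whose exact states appear in their tables
by induction; merging keeps at least the sum of the sizes. -/
theorem exists_mem_maxTable (t : JoinTree) (S : Finset t.Vert)
    (hS : ValidOffRoot t.graph t.root (· ∈ S)) :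
    ∃ a m, (a, m) ∈ t.maxTable ∧ a.Describes t.graph t.root (· ∈ S) ∧ S.card ≤ m := by
  induction t with
  | pt =>
    by_cases h : pt.root ∈ S
    · refine ⟨⟨true, true, false, false, false⟩, 1, by simp [maxTable], ⟨hS, ?_, ?_, ?_, ?_, ?_⟩,
        S.card_le_univ⟩ <;> simp [HasDeepChild, HasCloseTwin, HasFarTwin, Enclosed, graph, h]
    · refine ⟨⟨false, true, false, false, false⟩, 0, by simp [maxTable], ⟨hS, ?_, ?_, ?_, ?_, ?_⟩,
        ?_⟩
      rotate_right
      · rw [Nat.le_zero, Finset.card_eq_zero, Finset.eq_empty_iff_forall_notMem]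
        exact fun x => h
      all_goals simp [HasDeepChild, HasCloseTwin, HasFarTwin, Enclosed, graph, h]
  | join t s iht ihs =>
    obtain ⟨S, rfl⟩ : ∃ S' : Finset (t.Vert ⊕ s.Vert), S' = S := ⟨S, rfl⟩
    have hS' : ValidOffRoot (joinRoots t.graph s.graph t.root s.root) (.inl t.root)
      (fun x : t.Vert ⊕ s.Vert => x ∈ S) := hS
    obtain ⟨x, y, hx, hy, hxy, hc⟩ := Describes.join hS'
    have e1 : (fun x : t.Vert ⊕ s.Vert => x ∈ S) ∘ Sum.inl =
        (· ∈ Finset.toLeft S) := by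
      ext; simp
    have e2 : (fun x : t.Vert ⊕ s.Vert => x ∈ S) ∘ Sum.inr =
        (· ∈ Finset.toRight S) := by
      ext; simp
    rw [e1] at hx
    rw [e2] at hy
    obtain ⟨x', m, hm, hx', hxm⟩ := iht _ hx.valid
    obtain ⟨y', k, hk, hy', hyk⟩ := ihs _ hy.valid
    have hxx := hx'.unique hx
    have hyy := hy'.unique hy
    subst hxx hyy
    have : (x'.merge y', m + k) ∈ (t.maxTable.flatMap fun x => s.maxTable.filterMap fun y =>
        bif x.1.clash y.1 then none else some (x.1.merge y.1, x.2 + y.2)) := by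
      rw [List.mem_flatMap]
      refine ⟨_, hm, ?_⟩
      rw [List.mem_filterMap]
      exact ⟨_, hk, by simp [hc]⟩
    obtain ⟨l, hl, hle⟩ := exists_mem_foldr_insertMax this
    refine ⟨_, l, hl, hxy, le_trans ?_ hle⟩
    have := Finset.card_toLeft_add_card_toRight (u := S)
    exact this.symm.le.trans (Nat.add_le_add hxm hyk)

/-- No identifying code of `t` misses more vertices than the table allows. -/
theorem le_of_hasCodeMissing {t : JoinTree} {m k : ℕ} (hG : t.graph.IsAcyclic)
    (hk : (t.maxTable.all fun e => !e.1.isFinal || decide (e.2 ≤ k)) = true)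
    (h : HasCodeMissing t.graph m) : m ≤ k := by
  obtain ⟨C, hC, hm⟩ := h
  rw [isIdentifyingCode_iff_rooted hG t.root] at hC
  have e : (fun x => x ∉ C) = (· ∈ Cᶜ) := by ext; simp
  rw [e] at hC
  obtain ⟨hv, h1, h2, h3⟩ := hC
  obtain ⟨a, l, hl, ha, hle⟩ := exists_mem_maxTable t Cᶜ hv
  have hf : a.isFinal = true := by
    have := ha.mem; have := ha.enclosed; have := ha.close; have := ha.far
    simp only [isFinal, Bool.not_eq_true', Bool.or_eq_false_iff, Bool.and_eq_false_iff]
    grind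
  have := List.all_eq_true.1 hk _ hl
  simp only [hf, Bool.not_true, Bool.false_or, decide_eq_true_eq] at this
  rw [Finset.card_compl] at hle
  omega

end JoinTree

/-! ### Degrees under joining -/

section ncard
variable {A B : Type*} {G : SimpleGraph A} {H : SimpleGraph B} {a : A} {b : B}

theorem ncard_neighborSet_joinRoots_inl_root [Finite A] :
    ((joinRoots G H a b).neighborSet (.inl a)).ncard = (G.neighborSet a).ncard + 1 := by
  have : (joinRoots G H a b).neighborSet (.inl a) =
      insert (Sum.inr b) (Sum.inl '' G.neighborSet a) := by
    ext (x | x) <;> simp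
  rw [this, Set.ncard_insert_of_notMem (by simp), Set.ncard_image_of_injective _ Sum.inl_injective]

theorem ncard_neighborSet_joinRoots_inr_root [Finite B] :
    ((joinRoots G H a b).neighborSet (.inr b)).ncard = (H.neighborSet b).ncard + 1 := by
  have : (joinRoots G H a b).neighborSet (.inr b) =
      insert (Sum.inl a) (Sum.inr '' H.neighborSet b) := by
    ext (x | x) <;> simp
  rw [this, Set.ncard_insert_of_notMem (by simp), Set.ncard_image_of_injective _ Sum.inr_injective]

theorem ncard_neighborSet_le_joinRoots_inl [Finite A] [Finite B] (v : A) :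
    (G.neighborSet v).ncard ≤ ((joinRoots G H a b).neighborSet (.inl v)).ncard := by
  rw [← Set.ncard_image_of_injective _ (Sum.inl_injective (β := B))]
  refine Set.ncard_le_ncard ?_ (Set.toFinite _)
  rintro _ ⟨w, hw, rfl⟩
  exact hw

theorem ncard_neighborSet_le_joinRoots_inr [Finite A] [Finite B] (v : B) :
    (H.neighborSet v).ncard ≤ ((joinRoots G H a b).neighborSet (.inr v)).ncard := by
  rw [← Set.ncard_image_of_injective _ (Sum.inr_injective (α := A))]
  refine Set.ncard_le_ncard ?_ (Set.toFinite _)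
  rintro _ ⟨w, hw, rfl⟩
  exact hw

end ncard

/-! ### Every finite tree is given by a term -/

namespace JoinTree

/-- Add a leaf to `t`, adjacent to the vertex `v`. -/
def addLeaf : (t : JoinTree) → t.Vert → JoinTree
  | pt, _ => join pt pt
  | join t s, .inl v => join (addLeaf t v) s
  | join t s, .inr v => join t (addLeaf s v)

/-- A description of `addLeaf` free of its recursion: `f` embeds the old tree as an induced
subgraph, and `x` is the new leaf. That `f` keeps the root is what carries the induction through a
join. -/
theorem exists_addLeaf : (t : JoinTree) → (v : t.Vert) →
    ∃ (f : t.Vert → (t.addLeaf v).Vert) (x : (t.addLeaf v).Vert), Function.Injective f ∧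
      f t.root = (t.addLeaf v).root ∧ (∀ y, y = x ∨ ∃ u, f u = y) ∧ (∀ u, f u ≠ x) ∧
      (∀ a b, (t.addLeaf v).graph.Adj (f a) (f b) ↔ t.graph.Adj a b) ∧
      ∀ a, (t.addLeaf v).graph.Adj (f a) x ↔ a = v
  | pt, v => ⟨(.inl : Unit → Unit ⊕ Unit), (.inr () : Unit ⊕ Unit), Sum.inl_injective, rfl,
      by rintro (y | y); exacts [.inr ⟨y, rfl⟩, .inl rfl], fun u => Sum.inl_ne_inr, fun a b => Iff.rfl,
      fun a => ⟨fun _ => rfl, fun _ => ⟨rfl, rfl⟩⟩⟩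
  | join t s, .inl v => by
    obtain ⟨f, x, h1, h2, h3, h4, h5, h6⟩ := exists_addLeaf t v
    refine ⟨(Sum.map f id : t.Vert ⊕ s.Vert → (t.addLeaf v).Vert ⊕ s.Vert),
      (.inl x : (t.addLeaf v).Vert ⊕ s.Vert), h1.sumMap Function.injective_id,
      congrArg Sum.inl h2, ?_, ?_, ?_, ?_⟩
    · rintro (y | y)
      · obtain rfl | ⟨u, rfl⟩ := h3 y
        · exact .inl rfl
        · exact .inr ⟨.inl u, rfl⟩
      · exact .inr ⟨.inr y, rfl⟩
    · rintro (u | u)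
      · exact fun h => h4 u (Sum.inl_injective h)
      · exact Sum.inr_ne_inl
    · rintro (a | a) (b | b)
      · exact h5 a b
      · change f a = _ ∧ _ ↔ a = _ ∧ _
        rw [← h2, h1.eq_iff]; rfl
      · change f b = _ ∧ _ ↔ b = _ ∧ _
        rw [← h2, h1.eq_iff]; rfl
      · exact Iff.rfl
    · rintro (a | a)
      · exact (h6 a).trans Sum.inl_injective.eq_iff.symm
      · change x = _ ∧ _ ↔ _
        constructor
        · rintro ⟨h, -⟩
          exact absurd (h2.trans h.symm) (h4 _)
        · exact fun h => absurd h Sum.inr_ne_inl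
  | join t s, .inr v => by
    obtain ⟨f, x, h1, h2, h3, h4, h5, h6⟩ := exists_addLeaf s v
    refine ⟨(Sum.map id f : t.Vert ⊕ s.Vert → t.Vert ⊕ (s.addLeaf v).Vert),
      (.inr x : t.Vert ⊕ (s.addLeaf v).Vert), Function.injective_id.sumMap h1,
      rfl, ?_, ?_, ?_, ?_⟩
    · rintro (y | y)
      · exact .inr ⟨.inl y, rfl⟩
      · obtain rfl | ⟨u, rfl⟩ := h3 y
        · exact .inl rfl
        · exact .inr ⟨.inr u, rfl⟩
    · rintro (u | u)
      · exact Sum.inl_ne_inr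
      · exact fun h => h4 u (Sum.inr_injective h)
    · rintro (a | a) (b | b)
      · exact Iff.rfl
      · change _ ∧ f b = _ ↔ _ ∧ b = _
        rw [← h2, h1.eq_iff]; rfl
      · change _ ∧ f a = _ ↔ _ ∧ a = _
        rw [← h2, h1.eq_iff]; rfl
      · exact h5 a b
    · rintro (a | a)
      · change _ ∧ x = _ ↔ _
        constructor
        · rintro ⟨-, h⟩
          exact absurd (h2.trans h.symm) (h4 _)
        · exact fun h => absurd h Sum.inl_ne_inr
      · exact (h6 a).trans Sum.inr_injective.eq_iff.symm

/-- Induction by deleting a leaf: a nontrivial tree has two leaves, so one of them is not the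
prescribed root, and `addLeaf` puts it back. -/
theorem exists_iso_of_card (n : ℕ) : ∀ {V : Type*} [Fintype V] (G : SimpleGraph V),
    G.IsTree → Fintype.card V = n → ∀ r : V, ∃ (t : JoinTree) (φ : G ≃g t.graph), φ r = t.root := by
  classical
  induction n with
  | zero => intro V _ G _ hV r; exact absurd hV (Fintype.card_pos_iff.2 ⟨r⟩).ne'
  | succ n ih =>
    intro V _ G hG hV r
    rcases subsingleton_or_nontrivial V with hs | hs
    · refine ⟨pt, ⟨⟨fun _ => (), fun _ => r, fun _ => Subsingleton.elim _ _, fun _ => rfl⟩, ?_⟩, rfl⟩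
      intro a b
      simp [Subsingleton.elim a b]
    · obtain ⟨l, hlr, hl⟩ : ∃ l, l ≠ r ∧ G.degree l = 1 := by
        obtain ⟨u, v, huv, hu, hv⟩ := hG.exists_ne_and_degree_eq_one
        by_cases h : u = r
        · exact ⟨v, fun h' => huv (h.trans h'.symm), hv⟩
        · exact ⟨u, h, hu⟩
      have hT : (G.induce {l}ᶜ).IsTree :=
        ⟨hG.connected.induce_compl_singleton_of_degree_eq_one hl, hG.isAcyclic.induce _⟩
      have hcard : Fintype.card ({l}ᶜ : Set V) = n := by
        rw [Fintype.card_compl_set, Set.card_singleton, hV]; rfl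
      obtain ⟨p, hp, hp'⟩ := SimpleGraph.degree_eq_one_iff_existsUnique_adj.1 hl
      obtain ⟨t, φ, hφ⟩ := ih (G.induce {l}ᶜ) hT hcard ⟨r, fun h => hlr h.symm⟩
      obtain ⟨f, x, h1, h2, h3, h4, h5, h6⟩ := exists_addLeaf t (φ ⟨p, fun h => hp.ne h.symm⟩)
      have mem {y : V} (hy : ¬ y = l) : y ∈ ({l}ᶜ : Set V) := hy
      let g : V → (t.addLeaf (φ ⟨p, fun h => hp.ne h.symm⟩)).Vert :=
        fun y => if hy : y = l then x else f (φ ⟨y, mem hy⟩)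
      have gl : g l = x := dif_pos rfl
      have gn {y : V} (hy : ¬ y = l) : g y = f (φ ⟨y, mem hy⟩) := dif_neg hy
      have hg : Function.Bijective g := by
        constructor
        · intro y z hyz
          by_cases hy : y = l <;> by_cases hz : z = l
          · exact hy.trans hz.symm
          · rw [hy, gl, gn hz] at hyz
            exact absurd hyz.symm (h4 _)
          · rw [hz, gl, gn hy] at hyz
            exact absurd hyz (h4 _)
          · rw [gn hy, gn hz] at hyz
            simpa using φ.injective (h1 hyz)
        · intro y
          obtain rfl | ⟨u, rfl⟩ := h3 y
          · exact ⟨l, gl⟩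
          · refine ⟨(φ.symm u).1, ?_⟩
            rw [gn (φ.symm u).2]
            exact congrArg f (φ.apply_symm_apply u)
      refine ⟨_, ⟨Equiv.ofBijective g hg, ?_⟩, ?_⟩
      · have key (z : V) (hz : ¬ z = l) : (t.addLeaf (φ ⟨p, fun h => hp.ne h.symm⟩)).graph.Adj
            (g z) x ↔ G.Adj z l := by
          rw [gn hz, h6]
          constructor
          · intro h
            have := φ.injective h
            simp only [Subtype.mk.injEq] at this
            exact this ▸ hp.symm
          · intro h
            simp [hp' z h.symm]
        intro y z
        change (t.addLeaf _).graph.Adj (g y) (g z) ↔ _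
        by_cases hy : y = l <;> by_cases hz : z = l
        · simp [hy, hz]
        · rw [hy, gl, SimpleGraph.adj_comm, key z hz, SimpleGraph.adj_comm]
        · rw [hz, gl, key y hy]
        · rw [gn hy, gn hz, h5, φ.map_adj_iff]
          simp
      · change g r = _
        rw [gn (fun h => hlr h.symm), hφ, h2]

/-- Every vertex other than the root has fewer than `Δ` children. -/
def Bounded (Δ : ℕ) : JoinTree → Prop
  | pt => True
  | join t s => t.Bounded Δ ∧ s.Bounded Δ ∧ s.kids + 1 ≤ Δ

theorem ncard_neighborSet_root (t : JoinTree) : (t.graph.neighborSet t.root).ncard = t.kids := by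
  induction t with
  | pt => exact (Set.ncard_eq_zero (Set.toFinite _)).2 (Set.eq_empty_iff_forall_notMem.2 fun x h => h)
  | join t s iht ihs => exact ncard_neighborSet_joinRoots_inl_root.trans (congrArg (· + 1) iht)

theorem bounded_of_ncard_le {Δ : ℕ} (t : JoinTree) (h : ∀ v, (t.graph.neighborSet v).ncard ≤ Δ) :
    t.Bounded Δ := by
  induction t with
  | pt => trivial
  | join t s iht ihs =>
    refine ⟨iht fun v => le_trans ?_ (h (.inl v)), ihs fun v => le_trans ?_ (h (.inr v)),
      le_trans ?_ (h (.inr s.root))⟩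
    · exact ncard_neighborSet_le_joinRoots_inl v
    · exact ncard_neighborSet_le_joinRoots_inr v
    · rw [← ncard_neighborSet_root s]
      exact ncard_neighborSet_joinRoots_inr_root.ge

/-- A finite tree with at least two vertices can be rooted at a leaf. -/
theorem exists_iso_join_pt {V : Type*} [Fintype V] [Nontrivial V] {G : SimpleGraph V} {Δ : ℕ}
    (hG : G.IsTree) (hΔ : ∀ v, (G.neighborSet v).ncard ≤ Δ) :
    ∃ t : JoinTree, Nonempty (G ≃g (join pt t).graph) ∧ t.Bounded Δ ∧ t.kids + 1 ≤ Δ := by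
  classical
  obtain ⟨l, -, -, hl, -⟩ := hG.exists_ne_and_degree_eq_one
  obtain ⟨t, φ, hφ⟩ := exists_iso_of_card _ G hG rfl l
  have hcard (v : V) : (t.graph.neighborSet (φ v)).ncard = (G.neighborSet v).ncard :=
    (Nat.card_congr (φ.mapNeighborSet v)).symm
  have hb : t.Bounded Δ := bounded_of_ncard_le t fun v => by
    obtain ⟨v, rfl⟩ := φ.surjective v
    rw [hcard]
    exact hΔ v
  have hk : t.kids = 1 := by
    rw [← ncard_neighborSet_root, ← hφ, hcard, Set.ncard_eq_toFinset_card', ← hl]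
    rfl
  -- A root with one child forces the form `pt.join s`.
  match t, hk with
  | join pt s, _ => exact ⟨s, ⟨φ⟩, hb.2.1, hb.2.2⟩

end JoinTree

/-! ### Linear lower bounds and their calculus -/

namespace RootState

/-- `a` is at least as favourable as `b`. -/
def le (a b : RootState) : Bool :=
  (a.mem == b.mem) && (!a.enclosed || b.enclosed) && (!a.deep || b.deep) &&
    (!a.close || b.close) && (!a.far || b.far)

theorem Bounds.mono {V : Type*} {G : SimpleGraph V} {r : V} {S : V → Prop} {a b : RootState}
    (ha : a.Bounds G r S) (h : a.le b = true) : b.Bounds G r S := by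
  simp only [le, Bool.and_eq_true, beq_iff_eq, Bool.or_eq_true, Bool.not_eq_true'] at h
  obtain ⟨hv, h1, h2, h3, h4, h5⟩ := ha
  exact ⟨hv, by grind, by grind, by grind, by grind, by grind⟩

end RootState

/-- A linear lower bound for the size of suitable vertex sets in state `state`. -/
structure SizeBound where
  state : RootState
  const : ℤ
  slope : ℤ
  slack : ℤ

namespace SizeBound

/-- There is a suitable set whose size is at least
`(t.size + const + slope * D + slack * (Δ - 1 - t.kids)) / Δ`. -/
def Holds (Δ : ℕ) (D : ℤ) (t : JoinTree) (e : SizeBound) : Prop :=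
  ∃ m : ℕ, t.Realizes e.state m ∧
    (t.size : ℤ) + e.const + e.slope * D + e.slack * (Δ - 1 - t.kids) ≤ Δ * m

/-- The bound `e` implies the bound `f`; `wide` says that the root has at least three children. -/
def implies (wide : Bool) (e f : SizeBound) : Bool :=
  e.state.le f.state && decide (f.const ≤ e.const) && decide (f.slope ≤ e.slope) &&
    decide (f.slope + f.slack ≤ e.slope + e.slack) && (wide || decide (e.slack = f.slack))

theorem Holds.of_implies {Δ : ℕ} {D : ℤ} {t : JoinTree} {wide : Bool} {e f : SizeBound}
    (he : e.Holds Δ D t) (h : e.implies wide f = true) (hD : 0 ≤ D)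
    (hw : wide = true → (t.kids : ℤ) ≤ Δ - 1 ∧ (Δ - 1 - t.kids : ℤ) ≤ D) : f.Holds Δ D t := by
  simp only [implies, Bool.and_eq_true, decide_eq_true_eq, Bool.or_eq_true] at h
  obtain ⟨⟨⟨⟨h1, h2⟩, h3⟩, h4⟩, h5⟩ := h
  obtain ⟨m, ⟨S, hS, hb⟩, hm⟩ := he
  refine ⟨m, ⟨S, hS, hb.mono h1⟩, le_trans ?_ hm⟩
  obtain h5 | h5 := h5
  · obtain ⟨h6, h7⟩ := hw h5
    -- The bounds are compared as affine functions of `Δ - 1 - t.kids` on the interval from `0` to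
    -- `D`; `h3` and `h4` are the comparisons at its two ends.
    nlinarith [mul_nonneg (sub_nonneg.2 h3) (sub_nonneg.2 h7),
      mul_nonneg (sub_nonneg.2 h4) (sub_nonneg.2 h6)]
  · rw [h5]
    nlinarith [mul_nonneg (sub_nonneg.2 h3) hD]

/-- The bound resulting from joining trees. -/
def join? (e f : SizeBound) : Option SizeBound :=
  bif e.state.clash f.state || decide (f.slack < 0) then none
  else some ⟨e.state.merge f.state, e.const + f.const + e.slack, e.slope + f.slope, e.slack⟩

theorem Holds.join {Δ : ℕ} {D : ℤ} {t s : JoinTree} {e f g : SizeBound} (he : e.Holds Δ D t)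
    (hf : f.Holds Δ D s) (hs : s.kids + 1 ≤ Δ) (h : e.join? f = some g) :
    g.Holds Δ D (t.join s) := by
  unfold join? at h
  cases hc : e.state.clash f.state || decide (f.slack < 0)
  swap
  · simp [hc] at h
  rw [hc] at h
  simp only [cond_false, Option.some.injEq] at h
  subst h
  simp only [Bool.or_eq_false_iff, decide_eq_false_iff_not, not_lt] at hc
  obtain ⟨m, hr, hm⟩ := he
  obtain ⟨k, hr', hk⟩ := hf
  refine ⟨m + k, hr.join hr' hc.1, ?_⟩
  have : (s.kids : ℤ) + 1 ≤ Δ := by exact_mod_cast hs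
  simp only [JoinTree.size, JoinTree.kids]
  push_cast
  -- The new child lowers `Δ - 1 - kids` by one, which the summand `e.slack` in the new constant
  -- makes up for. The slack term of `s` is nonnegative and is dropped.
  nlinarith [mul_nonneg hc.2 (show (0 : ℤ) ≤ Δ - 1 - s.kids by linarith)]

end SizeBound

/-- The bounds resulting from joining trees for which the bounds in `P` and in `Q` hold. -/
def joinBounds (P Q : List SizeBound) : List SizeBound :=
  P.flatMap fun e => Q.filterMap fun f => e.join? f

/-- Every bound in `Q` is implied by one in `P`. -/
def impliesAll (wide : Bool) (P Q : List SizeBound) : Bool :=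
  Q.all fun f => P.any fun e => e.implies wide f

/-- Some bound in `P` gives a code missing at least a `Δ`-th of the vertices. -/
def suffices? (P : List SizeBound) : Bool :=
  P.any fun e => e.state.isFinal && decide (0 ≤ e.const) && decide (0 ≤ e.slope) &&
    decide (e.slack = 0)

theorem forall_mem_joinBounds {Δ : ℕ} {D : ℤ} {t s : JoinTree} {P Q : List SizeBound}
    (hP : ∀ e ∈ P, e.Holds Δ D t) (hQ : ∀ e ∈ Q, e.Holds Δ D s) (hs : s.kids + 1 ≤ Δ) :
    ∀ e ∈ joinBounds P Q, e.Holds Δ D (t.join s) := by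
  intro g hg
  simp only [joinBounds, List.mem_flatMap, List.mem_filterMap] at hg
  obtain ⟨e, he, f, hf, h⟩ := hg
  exact (hP e he).join (hQ f hf) hs h

theorem forall_of_impliesAll {Δ : ℕ} {D : ℤ} {t : JoinTree} {wide : Bool} {P Q : List SizeBound}
    (hP : ∀ e ∈ P, e.Holds Δ D t) (h : impliesAll wide P Q = true) (hD : 0 ≤ D)
    (hw : wide = true → (t.kids : ℤ) ≤ Δ - 1 ∧ (Δ - 1 - t.kids : ℤ) ≤ D) :
    ∀ e ∈ Q, e.Holds Δ D t := by
  intro f hf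
  obtain ⟨e, he, hef⟩ := List.any_eq_true.1 (List.all_eq_true.1 h f hf)
  exact (hP e he).of_implies hef hD hw

theorem exists_hasCodeMissing {Δ : ℕ} {D : ℤ} {t : JoinTree} {P : List SizeBound}
    (hP : ∀ e ∈ P, e.Holds Δ D t) (h : suffices? P = true) (hD : 0 ≤ D)
    (hG : t.graph.IsAcyclic) : ∃ m, HasCodeMissing t.graph m ∧ t.size ≤ Δ * m := by
  obtain ⟨e, he, h⟩ := List.any_eq_true.1 h
  simp only [Bool.and_eq_true, decide_eq_true_eq] at h
  obtain ⟨⟨⟨h1, h2⟩, h3⟩, h4⟩ := h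
  obtain ⟨m, hr, hm⟩ := hP e he
  refine ⟨m, hr.hasCodeMissing h1 hG, ?_⟩
  rw [h4] at hm
  have := mul_nonneg h3 hD
  zify
  linarith

/-- Leaving the single vertex out of `S` costs its size `1`; putting it into `S` gains `Δ - 1`,
which is to be written in terms of `D`. -/
theorem holds_pt {Δ : ℕ} {D c b : ℤ} (h : c + b * D = Δ - 1) :
    ∀ e ∈ ([⟨⟨false, true, false, false, false⟩, -1, 0, 0⟩,
      ⟨⟨true, true, false, false, false⟩, c, b, 0⟩] : List SizeBound), e.Holds Δ D .pt := by
  intro e he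
  simp only [List.mem_cons, List.not_mem_nil, or_false] at he
  obtain rfl | rfl := he
  · exact ⟨0, JoinTree.realizes_pt_out, by simp [JoinTree.size]⟩
  · exact ⟨1, JoinTree.realizes_pt_in, by simp [JoinTree.size]; linarith⟩

/-! ### Trees of large maximum degree -/

/-- The star with `k` leaves, rooted at its centre. -/
def JoinTree.star : ℕ → JoinTree
  | 0 => .pt
  | k + 1 => (star k).join .pt

@[simp] theorem JoinTree.kids_star (k : ℕ) : (JoinTree.star k).kids = k := by
  induction k with
  | zero => rfl
  | succ k ih => exact congrArg (· + 1) ih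

/-- A class of rooted trees: the root has `kids` children (at least `kids` children if `kids = 3`),
the bounds in `bounds` hold, and if `star` is set then the tree is a star rooted at its centre. -/
structure LargeClass where
  kids : ℕ
  star : Bool
  bounds : List SizeBound

structure LargeClass.Mem (Δ : ℕ) (D : ℤ) (x : LargeClass) (t : JoinTree) : Prop where
  kids : min 3 t.kids = x.kids
  star : x.star = true → t = .star t.kids
  holds : ∀ e ∈ x.bounds, e.Holds Δ D t

/-- The classes for maximum degree `Δ ≥ 4`, with `D = Δ - 4`. -/
def largeClasses : List LargeClass := [
  ⟨0, true, [⟨⟨false, true, false, false, false⟩, -1, 0, 0⟩,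
    ⟨⟨true, true, false, false, false⟩, 3, 1, 0⟩]⟩,
  ⟨1, false, [⟨⟨false, false, false, false, false⟩, 0, 1, 0⟩]⟩,
  ⟨1, true, [⟨⟨false, false, false, true, false⟩, -2, 0, 0⟩,
    ⟨⟨true, false, false, true, false⟩, 2, 1, 0⟩,
    ⟨⟨false, true, true, true, false⟩, 2, 1, 0⟩]⟩,
  ⟨1, false, [⟨⟨false, false, false, false, false⟩, -1, 0, 0⟩,
    ⟨⟨true, false, false, false, true⟩, 3, 1, 0⟩]⟩,
  ⟨1, false, [⟨⟨false, false, false, true, false⟩, 1, 1, 0⟩]⟩,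
  ⟨1, false, [⟨⟨false, false, false, false, false⟩, -2, 0, 0⟩,
    ⟨⟨false, true, false, false, false⟩, 2, 1, 0⟩]⟩,
  ⟨2, false, [⟨⟨false, false, false, false, false⟩, -1, 0, 0⟩,
    ⟨⟨true, false, false, false, false⟩, 3, 1, 0⟩]⟩,
  ⟨2, false, [⟨⟨false, false, false, false, false⟩, 0, 1, 0⟩]⟩,
  ⟨2, true, [⟨⟨false, false, false, false, false⟩, -3, 0, 0⟩,
    ⟨⟨false, false, true, true, false⟩, 1, 1, 0⟩]⟩,
  ⟨2, false, [⟨⟨false, false, true, false, false⟩, 2, 1, 0⟩]⟩,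
  ⟨2, false, [⟨⟨false, false, false, true, false⟩, 1, 1, 0⟩]⟩,
  ⟨3, false, [⟨⟨false, false, false, false, false⟩, -1, 0, 0⟩,
    ⟨⟨true, false, false, false, false⟩, 3, 1, 0⟩]⟩,
  ⟨3, false, [⟨⟨false, false, true, false, false⟩, 1, 0, 1⟩]⟩,
  ⟨3, false, [⟨⟨false, false, false, false, false⟩, 0, 0, 1⟩]⟩,
  ⟨3, true, [⟨⟨false, false, true, false, false⟩, 0, 0, 1⟩]⟩]

/-- The induction step for all `Δ ≥ 4` simultaneously, since the coefficients do not involve `Δ`.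
The value `3` for `kids` stands for three or more children, where `Δ - 1 - kids` is at most `D`. -/
theorem largeClasses_closed : (largeClasses.all fun x => largeClasses.all fun y =>
    largeClasses.any fun z => z.kids == min 3 (x.kids + 1) &&
      (!z.star || (x.star && y.kids == 0)) &&
        impliesAll (z.kids == 3) (joinBounds x.bounds y.bounds) z.bounds) = true := by
  decide +kernel

/-- The two kinds of class set aside are the single point, which gives a path on two vertices, and
the stars with at least three leaves. The explicit list consists of the bounds for the leaf used as
root. -/
theorem largeClasses_final : (largeClasses.all fun x => (x.star && (x.kids == 0 || x.kids == 3)) ||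
    suffices? (joinBounds [⟨⟨false, true, false, false, false⟩, -1, 0, 0⟩,
      ⟨⟨true, true, false, false, false⟩, 3, 1, 0⟩] x.bounds)) = true := by
  decide +kernel

theorem JoinTree.Bounded.exists_largeClass {Δ : ℕ} (hΔ : 4 ≤ Δ) {t : JoinTree} (ht : t.Bounded Δ)
    (hk : t.kids + 1 ≤ Δ) : ∃ x ∈ largeClasses, x.Mem Δ (Δ - 4) t := by
  have hΔ' : (4 : ℤ) ≤ Δ := by exact_mod_cast hΔ
  induction t with
  | pt =>
    exact ⟨_, List.mem_cons_self, rfl, fun _ => rfl, holds_pt (by ring)⟩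
  | join t s iht ihs =>
    obtain ⟨ht, hs, hsk⟩ := ht
    simp only [kids] at hk
    obtain ⟨x, hx, hxt⟩ := iht ht (by omega)
    obtain ⟨y, hy, hys⟩ := ihs hs hsk
    obtain ⟨z, hz, h⟩ := List.any_eq_true.1
      (List.all_eq_true.1 (List.all_eq_true.1 largeClasses_closed x hx) y hy)
    simp only [Bool.and_eq_true, beq_iff_eq, Bool.or_eq_true, Bool.not_eq_true'] at h
    obtain ⟨⟨h1, h2⟩, h3⟩ := h
    have hkids : min 3 (t.kids + 1) = z.kids := by rw [h1, ← hxt.kids]; omega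
    refine ⟨z, hz, hkids, fun hstar => ?_,
      forall_of_impliesAll (forall_mem_joinBounds hxt.holds hys.holds hsk) h3 (by linarith)
        fun hw => ?_⟩
    · obtain h2 | ⟨h2, h4⟩ := h2
      · simp [h2] at hstar
      · have hs0 : s.kids = 0 := by have := hys.kids; omega
        have : s = pt := by cases s <;> simp_all [kids]
        subst this
        simp only [kids, star]
        rw [← hxt.star h2]
    · have : 3 ≤ t.kids + 1 := by simp only [beq_iff_eq] at hw; omega
      simp only [kids]
      push_cast
      zify at this hk
      constructor <;> linarith

/-- Unless it is a star, a tree of maximum degree `Δ ≥ 4` has a code missing at least a `Δ`-th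
of its vertices. -/
theorem JoinTree.Bounded.exists_hasCodeMissing {Δ : ℕ} (hΔ : 4 ≤ Δ) {t : JoinTree}
    (ht : t.Bounded Δ) (hk : t.kids + 1 ≤ Δ) (hG : (join pt t).graph.IsAcyclic) :
    t = .star t.kids ∨
      ∃ m, HasCodeMissing (join pt t).graph m ∧ (join pt t).size ≤ Δ * m := by
  obtain ⟨x, hx, hxt⟩ := ht.exists_largeClass hΔ hk
  have h := List.all_eq_true.1 largeClasses_final x hx
  rw [Bool.or_eq_true, Bool.and_eq_true] at h
  obtain ⟨h, -⟩ | h := h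
  · exact .inl (hxt.star h)
  · have hΔ' : (4 : ℤ) ≤ Δ := by exact_mod_cast hΔ
    exact .inr (_root_.exists_hasCodeMissing
      (forall_mem_joinBounds (holds_pt (D := Δ - 4) (by ring)) hxt.holds hk) h (by linarith) hG)

/-! ### Isomorphisms of rooted trees -/

/-- The two rooted trees are isomorphic. -/
def JoinTree.Similar (t u : JoinTree) : Prop := ∃ φ : t.graph ≃g u.graph, φ t.root = u.root

namespace JoinTree.Similar

theorem refl (t : JoinTree) : t.Similar t := ⟨SimpleGraph.Iso.refl, rfl⟩

theorem trans {t u v : JoinTree} (h : t.Similar u) (h' : u.Similar v) : t.Similar v := by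
  obtain ⟨φ, hφ⟩ := h
  obtain ⟨ψ, hψ⟩ := h'
  exact ⟨φ.trans ψ, by rw [← hψ, ← hφ]; rfl⟩

theorem join {t t' s s' : JoinTree} (h : t.Similar t') (h' : s.Similar s') :
    (t.join s).Similar (t'.join s') := by
  obtain ⟨φ, hφ⟩ := h
  obtain ⟨ψ, hψ⟩ := h'
  refine ⟨⟨Equiv.sumCongr φ.toEquiv ψ.toEquiv, ?_⟩, congrArg Sum.inl hφ⟩
  rintro (a | a) (b | b)
  · exact φ.map_adj_iff
  · change φ a = _ ∧ ψ b = _ ↔ a = _ ∧ b = _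
    rw [← hφ, ← hψ, φ.injective.eq_iff, ψ.injective.eq_iff]
  · change φ b = _ ∧ ψ a = _ ↔ b = _ ∧ a = _
    rw [← hφ, ← hψ, φ.injective.eq_iff, ψ.injective.eq_iff]
  · exact ψ.map_adj_iff

/-- Terms are ordered trees, whereas `smallClasses` lists each shape with only one order of the
children. -/
theorem swap (t s u : JoinTree) : ((t.join s).join u).Similar ((t.join u).join s) := by
  refine ⟨⟨⟨Sum.elim (Sum.map .inl id) (.inl ∘ .inr), Sum.elim (Sum.map .inl id) (.inl ∘ .inr),
    ?_, ?_⟩, ?_⟩, rfl⟩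
  · rintro ((x | x) | x) <;> rfl
  · rintro ((x | x) | x) <;> rfl
  · rintro ((x | x) | x) ((y | y) | y)
    · exact Iff.rfl
    · exact ⟨fun h => ⟨Sum.inl_injective h.1, h.2⟩, fun h => ⟨congrArg Sum.inl h.1, h.2⟩⟩
    · exact ⟨fun h => ⟨congrArg Sum.inl h.1, h.2⟩, fun h => ⟨Sum.inl_injective h.1, h.2⟩⟩
    · exact ⟨fun h => ⟨Sum.inl_injective h.1, h.2⟩, fun h => ⟨congrArg Sum.inl h.1, h.2⟩⟩
    · exact Iff.rfl
    · exact ⟨fun h => absurd h.1 Sum.inr_ne_inl, fun h => absurd h.1 Sum.inr_ne_inl⟩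
    · exact ⟨fun h => ⟨congrArg Sum.inl h.1, h.2⟩, fun h => ⟨Sum.inl_injective h.1, h.2⟩⟩
    · exact ⟨fun h => absurd h.1 Sum.inr_ne_inl, fun h => absurd h.1 Sum.inr_ne_inl⟩
    · exact Iff.rfl

end JoinTree.Similar

/-! ### Trees of maximum degree three -/

namespace JoinTree

/-- A vertex with `k` appended 3-stars. -/
def stem : ℕ → JoinTree
  | 0 => pt
  | k + 1 => (stem k).join ((pt.join pt).join pt)

/-- The centre of a 3-star with appended 3-stars on two of its leaves, the third one being cut off. -/
def hub (x y : ℕ) : JoinTree := (pt.join (stem x)).join (stem y)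

end JoinTree

/-- A class of rooted trees: the root has `kids` children, the tree is isomorphic to the shape
if there is one, and the bounds in `bounds` hold. -/
structure SmallClass where
  kids : ℕ
  shape : Option JoinTree
  bounds : List SizeBound

structure SmallClass.Mem (x : SmallClass) (t : JoinTree) : Prop where
  kids : t.kids = x.kids
  shape : ∀ u, x.shape = some u → t.Similar u
  holds : ∀ e ∈ x.bounds, e.Holds 3 0 t

/-- If the shape `c` exists, it arises by joining `a` and `b`, up to the order of children. -/
def joinsTo (a b : Option JoinTree) : Option JoinTree → Bool
  | none => true
  | some w =>
    match a, b with
    | some u, some v => w == u.join v ||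
      match u with
      | .pt => false
      | .join u₁ u₂ => w == (u₁.join v).join u₂
    | _, _ => false

theorem similar_of_joinsTo {a b c : Option JoinTree} {t s w : JoinTree}
    (h : joinsTo a b c = true) (ht : ∀ u, a = some u → t.Similar u)
    (hs : ∀ u, b = some u → s.Similar u) (hw : c = some w) : (t.join s).Similar w := by
  subst hw
  match a, b with
  | none, _ => simp [joinsTo] at h
  | some _, none => simp [joinsTo] at h
  | some u, some v =>
    have hj := (ht u rfl).join (hs v rfl)
    simp only [joinsTo, Bool.or_eq_true, beq_iff_eq] at h
    obtain rfl | h := h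
    · exact hj
    · match u with
      | .pt => simp at h
      | .join u₁ u₂ =>
        simp only [beq_iff_eq] at h
        subst h
        exact hj.trans (.swap u₁ u₂ v)

section
open JoinTree

local notation "◦" => JoinTree.pt
local infixl:65 " ⋈ " => JoinTree.join

/-- The classes for maximum degree three. -/
def smallClasses : List SmallClass :=
  ([◦].map fun t =>
    ⟨0, some t, [⟨⟨false, true, false, false, false⟩, -1, 0, 0⟩,
      ⟨⟨true, true, false, false, false⟩, 2, 0, 0⟩]⟩) ++
  ([◦ ⋈ ◦].map fun t =>
    ⟨1, some t, [⟨⟨true, false, false, true, false⟩, 1, 0, 0⟩,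
      ⟨⟨false, true, true, true, false⟩, 1, 0, 0⟩]⟩) ++
  ([hub 0 0].map fun t =>
    ⟨2, some t, [⟨⟨true, false, false, false, false⟩, 0, 0, 0⟩,
      ⟨⟨false, false, true, true, false⟩, 0, 0, 0⟩]⟩) ++
  ([◦ ⋈ (◦ ⋈ ◦)].map fun t =>
    ⟨1, some t, [⟨⟨false, true, false, false, false⟩, 0, 0, 0⟩,
      ⟨⟨false, false, false, true, false⟩, 0, 0, 0⟩]⟩) ++
  ([stem 1].map fun t =>
    ⟨1, some t, [⟨⟨false, false, false, false, false⟩, -1, 0, 0⟩,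
      ⟨⟨true, true, false, false, false⟩, 2, 0, 0⟩]⟩) ++
  ([◦ ⋈ (◦ ⋈ (◦ ⋈ ◦))].map fun t =>
    ⟨1, some t, [⟨⟨false, false, false, false, false⟩, -1, 0, 0⟩,
      ⟨⟨true, false, false, true, false⟩, 2, 0, 0⟩]⟩) ++
  ([◦ ⋈ (stem 1), ◦ ⋈ (stem 2)].map fun t =>
    ⟨1, some t, [⟨⟨false, false, false, false, false⟩, -2, 0, 0⟩,
      ⟨⟨true, false, false, false, false⟩, 1, 0, 0⟩,
      ⟨⟨false, true, true, true, false⟩, 1, 0, 0⟩]⟩) ++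
  ([◦ ⋈ (◦ ⋈ (◦ ⋈ (◦ ⋈ ◦))), ◦ ⋈ (◦ ⋈ (hub 0 0) ⋈ (◦ ⋈ (◦ ⋈ ◦))), ◦ ⋈ (◦ ⋈ (hub 0 1)),
    ◦ ⋈ (◦ ⋈ (hub 0 0) ⋈ (hub 0 1)), ◦ ⋈ (◦ ⋈ (hub 0 2)), ◦ ⋈ (◦ ⋈ (hub 1 1)),
    ◦ ⋈ (◦ ⋈ (hub 0 0) ⋈ (hub 0 2)), ◦ ⋈ (◦ ⋈ (hub 0 0) ⋈ (hub 1 1)), ◦ ⋈ (◦ ⋈ (hub 1 2)),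
    ◦ ⋈ (◦ ⋈ (hub 0 0) ⋈ (hub 1 2)), ◦ ⋈ (◦ ⋈ (hub 2 2)), ◦ ⋈ (◦ ⋈ (hub 0 0) ⋈ (hub 2 2))].map fun t =>
    ⟨1, some t, [⟨⟨true, false, false, false, false⟩, 1, 0, 0⟩,
      ⟨⟨false, true, false, false, false⟩, 1, 0, 0⟩]⟩) ++
  ([hub 0 1, hub 0 2, hub 1 1, hub 1 2, hub 2 2].map fun t =>
    ⟨2, some t, [⟨⟨false, false, true, false, false⟩, 0, 0, 0⟩]⟩) ++
  ([◦ ⋈ ◦ ⋈ (◦ ⋈ (◦ ⋈ (◦ ⋈ ◦))), ◦ ⋈ ◦ ⋈ (◦ ⋈ (hub 0 0) ⋈ (◦ ⋈ (◦ ⋈ ◦))),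
    ◦ ⋈ ◦ ⋈ (◦ ⋈ (hub 0 1)), ◦ ⋈ ◦ ⋈ (◦ ⋈ (hub 0 0) ⋈ (hub 0 1)), ◦ ⋈ ◦ ⋈ (◦ ⋈ (hub 0 2)),
    ◦ ⋈ ◦ ⋈ (◦ ⋈ (hub 1 1)), ◦ ⋈ ◦ ⋈ (◦ ⋈ (hub 0 0) ⋈ (hub 0 2)),
    ◦ ⋈ ◦ ⋈ (◦ ⋈ (hub 0 0) ⋈ (hub 1 1)), ◦ ⋈ ◦ ⋈ (◦ ⋈ (hub 1 2)),
    ◦ ⋈ ◦ ⋈ (◦ ⋈ (hub 0 0) ⋈ (hub 1 2)), ◦ ⋈ ◦ ⋈ (◦ ⋈ (hub 2 2)),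
    ◦ ⋈ ◦ ⋈ (◦ ⋈ (hub 0 0) ⋈ (hub 2 2))].map fun t =>
    ⟨2, some t, [⟨⟨false, true, true, true, false⟩, 3, 0, 0⟩]⟩) ++
  ([◦ ⋈ (◦ ⋈ (stem 1)), ◦ ⋈ (◦ ⋈ (stem 2))].map fun t =>
    ⟨1, some t, [⟨⟨true, true, false, false, false⟩, 3, 0, 0⟩,
      ⟨⟨false, false, false, true, false⟩, 0, 0, 0⟩]⟩) ++
  ([stem 2].map fun t =>
    ⟨2, some t, [⟨⟨false, false, false, false, false⟩, -1, 0, 0⟩,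
      ⟨⟨true, true, false, false, false⟩, 2, 0, 0⟩]⟩) ++
  ([◦ ⋈ (hub 0 0) ⋈ (◦ ⋈ (◦ ⋈ ◦))].map fun t =>
    ⟨2, some t, [⟨⟨false, false, false, false, false⟩, -1, 0, 0⟩,
      ⟨⟨true, false, false, true, false⟩, 2, 0, 0⟩]⟩) ++
  ([◦ ⋈ (hub 0 1), ◦ ⋈ (hub 0 2), ◦ ⋈ (hub 1 1), ◦ ⋈ (hub 1 2), ◦ ⋈ (hub 2 2)].map fun t =>
    ⟨1, some t, [⟨⟨false, false, false, false, false⟩, -1, 0, 0⟩,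
      ⟨⟨true, false, false, false, true⟩, 2, 0, 0⟩]⟩) ++
  ([◦ ⋈ (hub 0 0) ⋈ (hub 0 1), ◦ ⋈ (hub 0 0) ⋈ (hub 0 2), ◦ ⋈ (hub 0 0) ⋈ (hub 1 1),
    ◦ ⋈ (hub 0 0) ⋈ (hub 1 2), ◦ ⋈ (hub 0 0) ⋈ (hub 2 2)].map fun t =>
    ⟨2, some t, [⟨⟨false, false, false, false, false⟩, -1, 0, 0⟩,
      ⟨⟨true, false, false, false, true⟩, 2, 0, 0⟩]⟩) ++
  [⟨1, none, [⟨⟨false, false, false, false, false⟩, 0, 0, 0⟩]⟩,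
    ⟨1, none, [⟨⟨true, false, false, false, false⟩, 1, 0, 0⟩,
      ⟨⟨false, true, false, false, false⟩, 1, 0, 0⟩,
      ⟨⟨true, true, false, false, false⟩, 4, 0, 0⟩]⟩,
    ⟨1, none, [⟨⟨false, false, false, false, false⟩, -1, 0, 0⟩,
      ⟨⟨true, false, false, false, false⟩, 2, 0, 0⟩]⟩,
    ⟨1, none, [⟨⟨false, false, false, true, false⟩, 0, 0, 0⟩,
      ⟨⟨true, false, false, true, false⟩, 3, 0, 0⟩]⟩,
    ⟨1, none, [⟨⟨false, false, false, true, false⟩, 1, 0, 0⟩]⟩,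
    ⟨1, none, [⟨⟨false, false, false, false, false⟩, -1, 0, 0⟩,
      ⟨⟨false, true, true, true, false⟩, 2, 0, 0⟩]⟩,
    ⟨2, none, [⟨⟨true, false, false, true, false⟩, 3, 0, 0⟩,
      ⟨⟨false, true, true, true, false⟩, 3, 0, 0⟩]⟩,
    ⟨2, none, [⟨⟨false, false, true, true, false⟩, 2, 0, 0⟩]⟩,
    ⟨2, none, [⟨⟨false, false, false, false, false⟩, -1, 0, 0⟩,
      ⟨⟨true, false, false, false, false⟩, 2, 0, 0⟩]⟩,
    ⟨2, none, [⟨⟨false, false, false, false, false⟩, 0, 0, 0⟩]⟩,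
    ⟨2, none, [⟨⟨false, false, true, false, false⟩, 1, 0, 0⟩]⟩]

/-- The trees that are one leaf short of an exceptional tree, rooted next to this leaf. -/
def extremalBranches : List JoinTree :=
  [hub 0 0, hub 0 1, ◦ ⋈ (◦ ⋈ (stem 1)), ◦ ⋈ ◦ ⋈ (◦ ⋈ (◦ ⋈ (◦ ⋈ ◦))), ◦ ⋈ (◦ ⋈ (stem 2)),
   ◦ ⋈ ◦ ⋈ (◦ ⋈ (hub 0 0) ⋈ (◦ ⋈ (◦ ⋈ ◦))), hub 0 2, hub 1 1, ◦ ⋈ ◦ ⋈ (◦ ⋈ (hub 0 1)),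
   ◦ ⋈ ◦ ⋈ (◦ ⋈ (hub 1 1)), hub 1 2, ◦ ⋈ ◦ ⋈ (◦ ⋈ (hub 0 0) ⋈ (hub 0 1)),
   ◦ ⋈ ◦ ⋈ (◦ ⋈ (hub 0 2)), ◦ ⋈ ◦ ⋈ (◦ ⋈ (hub 0 0) ⋈ (hub 1 1)), ◦ ⋈ ◦ ⋈ (◦ ⋈ (hub 1 2)),
   hub 2 2, ◦ ⋈ ◦ ⋈ (◦ ⋈ (hub 0 0) ⋈ (hub 0 2)), ◦ ⋈ ◦ ⋈ (◦ ⋈ (hub 0 0) ⋈ (hub 1 2)),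
   ◦ ⋈ ◦ ⋈ (◦ ⋈ (hub 2 2)), ◦ ⋈ ◦ ⋈ (◦ ⋈ (hub 0 0) ⋈ (hub 2 2))]

/-- The induction step for `Δ = 3`. Roots with two children are skipped, since a vertex that still
gets a parent has no room for a third. Classes without a shape have bounds good enough that the
isomorphism type may be forgotten. -/
theorem smallClasses_closed : (smallClasses.all fun x => x.kids == 2 ||
    smallClasses.all fun y => smallClasses.any fun z => z.kids == x.kids + 1 &&
      joinsTo x.shape y.shape z.shape &&
        impliesAll false (joinBounds x.bounds y.bounds) z.bounds) = true := by
  decide +kernel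

/-- Besides the exceptional trees, the bound can only fail for the paths on two and four vertices,
which come from the first two shapes set aside. -/
theorem smallClasses_final : (smallClasses.all fun x =>
    suffices? (joinBounds [⟨⟨false, true, false, false, false⟩, -1, 0, 0⟩,
      ⟨⟨true, true, false, false, false⟩, 2, 0, 0⟩] x.bounds) ||
    x.shape == some ◦ || x.shape == some (◦ ⋈ (◦ ⋈ ◦)) ||
    extremalBranches.any fun u => x.shape == some u) = true := by
  decide +kernel

theorem JoinTree.Bounded.exists_smallClass {t : JoinTree} (ht : t.Bounded 3)
    (hk : t.kids + 1 ≤ 3) : ∃ x ∈ smallClasses, x.Mem t := by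
  induction t with
  | pt =>
    exact ⟨_, List.mem_cons_self, rfl, fun u hu => Option.some.inj hu ▸ .refl _,
      holds_pt (by norm_num)⟩
  | join t s iht ihs =>
    obtain ⟨ht, hs, hsk⟩ := ht
    simp only [kids] at hk
    obtain ⟨x, hx, hxt⟩ := iht ht (by omega)
    obtain ⟨y, hy, hys⟩ := ihs hs hsk
    have h := List.all_eq_true.1 smallClasses_closed x hx
    have hx2 : (x.kids == 2) = false := by
      have := hxt.kids
      simp only [beq_eq_false_iff_ne]
      omega
    rw [hx2, Bool.false_or] at h
    obtain ⟨z, hz, h⟩ := List.any_eq_true.1 (List.all_eq_true.1 h y hy)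
    simp only [Bool.and_eq_true, beq_iff_eq] at h
    obtain ⟨⟨h1, h2⟩, h3⟩ := h
    exact ⟨z, hz, by rw [h1, ← hxt.kids]; rfl,
      fun u hu => similar_of_joinsTo h2 hxt.shape hys.shape hu,
      forall_of_impliesAll (forall_mem_joinBounds hxt.holds hys.holds hsk) h3 le_rfl (by simp)⟩

/-- With explicit exceptions, a tree of maximum degree three has a code missing at least a third
of its vertices. -/
theorem JoinTree.Bounded.exists_hasCodeMissing_three {t : JoinTree} (ht : t.Bounded 3)
    (hk : t.kids + 1 ≤ 3) (hG : (pt.join t).graph.IsAcyclic) :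
    (∃ m, HasCodeMissing (pt.join t).graph m ∧ (pt.join t).size ≤ 3 * m) ∨
      t.Similar ◦ ∨ t.Similar (◦ ⋈ (◦ ⋈ ◦)) ∨ ∃ u ∈ extremalBranches, t.Similar u := by
  obtain ⟨x, hx, hxt⟩ := ht.exists_smallClass hk
  have h := List.all_eq_true.1 smallClasses_final x hx
  simp only [Bool.or_eq_true, beq_iff_eq, List.any_eq_true] at h
  obtain ((h | h) | h) | ⟨u, hu, h⟩ := h
  · exact .inl (_root_.exists_hasCodeMissing
      (forall_mem_joinBounds (holds_pt (by norm_num)) hxt.holds hk) h le_rfl hG)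
  · exact .inr (.inl (hxt.shape _ h))
  · exact .inr (.inr (.inl (hxt.shape _ h)))
  · exact .inr (.inr (.inr ⟨u, hu, hxt.shape _ h⟩))

end

namespace JoinTree
open RootState

/-! ### Explicit isomorphisms -/

/-- The vertices in preorder. -/
def verts : (t : JoinTree) → List t.Vert
  | pt => [()]
  | join t s => (verts t).map Sum.inl ++ (verts s).map Sum.inr

/-- The position of a vertex in the preorder. -/
def index : (t : JoinTree) → t.Vert → ℕ
  | pt, _ => 0
  | join t _, .inl v => index t v
  | join t s, .inr v => t.size + index s v

def isRoot : (t : JoinTree) → t.Vert → Bool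
  | pt, _ => true
  | join t _, .inl v => isRoot t v
  | join _ _, .inr _ => false

/-- A Boolean form of adjacency, which lets isomorphisms and degrees of concrete trees be checked by
evaluation. -/
def isAdj : (t : JoinTree) → t.Vert → t.Vert → Bool
  | pt, _, _ => false
  | join t _, .inl v, .inl w => isAdj t v w
  | join _ s, .inr v, .inr w => isAdj s v w
  | join t s, .inl v, .inr w => isRoot t v && isRoot s w
  | join t s, .inr w, .inl v => isRoot t v && isRoot s w

theorem mem_verts : (t : JoinTree) → (v : t.Vert) → v ∈ t.verts
  | pt, _ => List.mem_singleton.2 rfl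
  | join t _, .inl v => List.mem_append_left _ (List.mem_map_of_mem (mem_verts t v))
  | join _ s, .inr v => List.mem_append_right _ (List.mem_map_of_mem (mem_verts s v))

theorem isRoot_iff : (t : JoinTree) → (v : t.Vert) → (t.isRoot v = true ↔ v = t.root)
  | pt, _ => ⟨fun _ => rfl, fun _ => rfl⟩
  | join t _, .inl v => (isRoot_iff t v).trans Sum.inl_injective.eq_iff.symm
  | join _ _, .inr _ => ⟨fun h => Bool.noConfusion h, fun h => absurd h Sum.inr_ne_inl⟩

theorem isAdj_iff : (t : JoinTree) → (v w : t.Vert) → (t.isAdj v w = true ↔ t.graph.Adj v w)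
  | pt, _, _ => ⟨fun h => Bool.noConfusion h, fun h => h.elim⟩
  | join t _, .inl v, .inl w => isAdj_iff t v w
  | join _ s, .inr v, .inr w => isAdj_iff s v w
  | join t s, .inl v, .inr w =>
    (Bool.and_eq_true_iff).trans (and_congr (isRoot_iff t v) (isRoot_iff s w))
  | join t s, .inr w, .inl v =>
    (Bool.and_eq_true_iff).trans (and_congr (isRoot_iff t v) (isRoot_iff s w))

theorem ncard_neighborSet_le (t : JoinTree) (v : t.Vert) :
    (t.graph.neighborSet v).ncard ≤ (t.verts.filter (t.isAdj v)).length := by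
  classical
  refine le_trans ?_ (List.toFinset_card_le _)
  rw [← Set.ncard_coe_finset]
  refine Set.ncard_le_ncard (fun w hw => ?_) (Set.toFinite _)
  simp only [List.coe_toFinset, List.mem_filter, Set.mem_ofPred_eq]
  exact ⟨mem_verts t w, (isAdj_iff t v w).2 hw⟩

/-- A numbering of the vertices that is checked to be an isomorphism. -/
theorem nonempty_iso_graphOfEdges {t : JoinTree} {m : ℕ} [NeZero m] {E : List (Fin m × Fin m)}
    (p : List (Fin m)) (hm : t.size = m)
    (h : (t.verts.all fun u => t.verts.all fun v =>
      (p.getD (t.index u) 0 != p.getD (t.index v) 0 || decide (u = v)) &&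
        (t.isAdj u v == (p.getD (t.index u) 0 != p.getD (t.index v) 0 && E.any fun e =>
          (e.1 == p.getD (t.index u) 0 && e.2 == p.getD (t.index v) 0) ||
            (e.1 == p.getD (t.index v) 0 && e.2 == p.getD (t.index u) 0)))) = true) :
    Nonempty (t.graph ≃g graphOfEdges m E) := by
  have key (u v : t.Vert) := List.all_eq_true.1 (List.all_eq_true.1 h u (mem_verts t u)) v
    (mem_verts t v)
  simp only [Bool.and_eq_true, Bool.or_eq_true, decide_eq_true_eq, bne_iff_ne, beq_iff_eq] at key
  have hinj : Function.Injective fun v => p.getD (t.index v) 0 := fun u v huv =>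
    (key u v).1.resolve_left fun h => h huv
  refine ⟨⟨Equiv.ofBijective _ ((Fintype.bijective_iff_injective_and_card _).2 ⟨hinj, ?_⟩), ?_⟩⟩
  · rw [card_vert, hm, Fintype.card_fin]
  · intro u v
    rw [← isAdj_iff, (key u v).2]
    simp only [Equiv.ofBijective_apply, graphOfEdges, SimpleGraph.fromRel_adj, Bool.and_eq_true,
      bne_iff_ne, List.any_eq_true, Bool.or_eq_true, beq_iff_eq]
    refine and_congr_right fun _ => ⟨?_, ?_⟩
    · rintro (h | h)
      · exact ⟨_, h, .inl ⟨rfl, rfl⟩⟩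
      · exact ⟨_, h, .inr ⟨rfl, rfl⟩⟩
    · rintro ⟨⟨x, y⟩, h, ⟨rfl, rfl⟩ | ⟨rfl, rfl⟩⟩
      · exact .inl h
      · exact .inr h

end JoinTree

section
open JoinTree

local notation "◦" => JoinTree.pt
local infixl:65 " ⋈ " => JoinTree.join

/-- Here and below, the list gives the labels of the vertices in preorder. -/
theorem nonempty_iso_exTree0 : Nonempty ((◦ ⋈ (hub 0 0)).graph ≃g exTree0) :=
  nonempty_iso_graphOfEdges [1, 0, 2, 3] rfl (by decide +kernel)

theorem nonempty_iso_exTree1 : Nonempty ((◦ ⋈ (hub 0 1)).graph ≃g exTree1) :=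
  nonempty_iso_graphOfEdges [2, 0, 3, 1, 4, 5, 6] rfl (by decide +kernel)

theorem nonempty_iso_exTree2 : Nonempty ((◦ ⋈ (◦ ⋈ (◦ ⋈ (stem 1)))).graph ≃g exTree2) :=
  nonempty_iso_graphOfEdges [0, 1, 2, 3, 4, 5, 6] rfl (by decide +kernel)

theorem nonempty_iso_exTree3 : Nonempty ((◦ ⋈ (◦ ⋈ (◦ ⋈ (stem 2)))).graph ≃g exTree3) :=
  nonempty_iso_graphOfEdges [0, 1, 2, 3, 4, 5, 6, 7, 8, 9] rfl (by decide +kernel)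

theorem nonempty_iso_exTree4 : Nonempty ((◦ ⋈ (hub 0 2)).graph ≃g exTree4) :=
  nonempty_iso_graphOfEdges [2, 0, 3, 1, 4, 5, 6, 7, 8, 9] rfl (by decide +kernel)

theorem nonempty_iso_exTree5 : Nonempty ((◦ ⋈ (hub 1 1)).graph ≃g exTree5) :=
  nonempty_iso_graphOfEdges [3, 0, 1, 4, 5, 6, 2, 7, 8, 9] rfl (by decide +kernel)

theorem nonempty_iso_exTree6 : Nonempty ((◦ ⋈ (◦ ⋈ ◦ ⋈ (◦ ⋈ (hub 1 1)))).graph ≃g exTree6) :=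
  nonempty_iso_graphOfEdges [5, 4, 6, 1, 0, 2, 7, 8, 9, 3, 10, 11, 12] rfl (by decide +kernel)

theorem nonempty_iso_exTree7 : Nonempty ((◦ ⋈ (hub 1 2)).graph ≃g exTree7) :=
  nonempty_iso_graphOfEdges [3, 0, 2, 10, 11, 12, 1, 4, 5, 6, 7, 8, 9] rfl (by decide +kernel)

theorem nonempty_iso_exTree8 : Nonempty ((◦ ⋈ (◦ ⋈ ◦ ⋈ (◦ ⋈ (hub 0 0) ⋈ (hub 1 1)))).graph ≃g exTree8) :=
  nonempty_iso_graphOfEdges [5, 4, 6, 1, 7, 8, 9, 0, 2, 10, 11, 12, 3, 13, 14, 15] rfl (by decide +kernel)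

theorem nonempty_iso_exTree9 : Nonempty ((◦ ⋈ (hub 2 2)).graph ≃g exTree9) :=
  nonempty_iso_graphOfEdges [3, 0, 1, 4, 5, 6, 7, 8, 9, 2, 10, 11, 12, 13, 14, 15] rfl (by decide +kernel)

theorem nonempty_iso_exTree10 : Nonempty ((◦ ⋈ (◦ ⋈ ◦ ⋈ (◦ ⋈ (hub 0 0) ⋈ (hub 1 2)))).graph ≃g exTree10) :=
  nonempty_iso_graphOfEdges [5, 4, 6, 1, 7, 8, 9, 0, 3, 16, 17, 18, 2, 10, 11, 12, 13, 14, 15] rfl (by decide +kernel)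

theorem nonempty_iso_exTree11 : Nonempty ((◦ ⋈ (◦ ⋈ ◦ ⋈ (◦ ⋈ (hub 0 0) ⋈ (hub 2 2)))).graph ≃g exTree11) :=
  nonempty_iso_graphOfEdges [5, 4, 6, 1, 7, 8, 9, 0, 2, 10, 11, 12, 13, 14, 15, 3, 16, 17, 18, 19, 20, 21] rfl (by decide +kernel)

/-- Several branches yield the same tree because it can be rooted at inequivalent leaves. -/
theorem isExceptional_of_mem_extremalBranches {u : JoinTree} (hu : u ∈ extremalBranches) :
    IsExceptional 3 (◦ ⋈ u).graph := by
  have key {W : Type} {T : SimpleGraph W} (h : (⟨W, T⟩ : Σ V : Type, SimpleGraph V) ∈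
      exceptionalTrees 3) (h' : Nonempty ((◦ ⋈ u).graph ≃g T)) : IsExceptional 3 (◦ ⋈ u).graph :=
    ⟨⟨W, T⟩, h, h'⟩
  simp only [exceptionalTrees, if_true] at key
  simp only [extremalBranches, List.mem_cons, List.not_mem_nil, or_false] at hu
  obtain rfl | rfl | rfl | rfl | rfl | rfl | rfl | rfl | rfl | rfl | rfl | rfl | rfl | rfl | rfl | rfl | rfl | rfl | rfl | rfl := hu
  · exact key (T := exTree0) (by simp) nonempty_iso_exTree0
  · exact key (T := exTree1) (by simp) nonempty_iso_exTree1
  · exact key (T := exTree2) (by simp) nonempty_iso_exTree2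
  · exact key (T := exTree2) (by simp) 
      (nonempty_iso_graphOfEdges [5, 4, 6, 3, 2, 1, 0] rfl (by decide +kernel))
  · exact key (T := exTree3) (by simp) nonempty_iso_exTree3
  · exact key (T := exTree3) (by simp) 
      (nonempty_iso_graphOfEdges [5, 4, 6, 3, 7, 8, 9, 2, 1, 0] rfl (by decide +kernel))
  · exact key (T := exTree4) (by simp) nonempty_iso_exTree4
  · exact key (T := exTree5) (by simp) nonempty_iso_exTree5
  · exact key (T := exTree5) (by simp) 
      (nonempty_iso_graphOfEdges [5, 4, 6, 1, 0, 3, 2, 7, 8, 9] rfl (by decide +kernel))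
  · exact key (T := exTree6) (by simp) nonempty_iso_exTree6
  · exact key (T := exTree7) (by simp) nonempty_iso_exTree7
  · exact key (T := exTree7) (by simp) 
      (nonempty_iso_graphOfEdges [5, 4, 6, 1, 7, 8, 9, 0, 3, 2, 10, 11, 12] rfl (by decide +kernel))
  · exact key (T := exTree7) (by simp) 
      (nonempty_iso_graphOfEdges [11, 10, 12, 2, 0, 3, 1, 4, 5, 6, 7, 8, 9] rfl (by decide +kernel))
  · exact key (T := exTree8) (by simp) nonempty_iso_exTree8
  · exact key (T := exTree8) (by simp) 
      (nonempty_iso_graphOfEdges [11, 10, 12, 2, 0, 3, 13, 14, 15, 1, 4, 5, 6, 7, 8, 9] rfl (by decide +kernel))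
  · exact key (T := exTree9) (by simp) nonempty_iso_exTree9
  · exact key (T := exTree9) (by simp) 
      (nonempty_iso_graphOfEdges [5, 4, 6, 1, 7, 8, 9, 0, 3, 2, 10, 11, 12, 13, 14, 15] rfl (by decide +kernel))
  · exact key (T := exTree10) (by simp) nonempty_iso_exTree10
  · exact key (T := exTree10) (by simp) 
      (nonempty_iso_graphOfEdges [17, 16, 18, 3, 0, 1, 4, 5, 6, 7, 8, 9, 2, 10, 11, 12, 13, 14, 15] rfl (by decide +kernel))
  · exact key (T := exTree11) (by simp) nonempty_iso_exTree11

theorem exists_extremalBranch_of_isExceptional {V : Type*} {G : SimpleGraph V}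
    (hG : IsExceptional 3 G) :
    ∃ u ∈ extremalBranches, Nonempty (G ≃g (◦ ⋈ u).graph) := by
  obtain ⟨T, hT, ⟨φ⟩⟩ := hG
  have key {W : Type} {T : SimpleGraph W} {u : JoinTree} (hu : u ∈ extremalBranches)
      (φ : G ≃g T) (h : Nonempty ((◦ ⋈ u).graph ≃g T)) :
      ∃ u ∈ extremalBranches, Nonempty (G ≃g (◦ ⋈ u).graph) :=
    ⟨u, hu, h.map fun ψ => φ.trans ψ.symm⟩
  simp only [exceptionalTrees, if_true, Set.mem_insert_iff, Set.mem_singleton_iff] at hT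
  obtain rfl | rfl | rfl | rfl | rfl | rfl | rfl | rfl | rfl | rfl | rfl | rfl := hT
  · exact key (by simp [extremalBranches]) φ nonempty_iso_exTree0
  · exact key (by simp [extremalBranches]) φ nonempty_iso_exTree1
  · exact key (by simp [extremalBranches]) φ nonempty_iso_exTree2
  · exact key (by simp [extremalBranches]) φ nonempty_iso_exTree3
  · exact key (by simp [extremalBranches]) φ nonempty_iso_exTree4
  · exact key (by simp [extremalBranches]) φ nonempty_iso_exTree5
  · exact key (by simp [extremalBranches]) φ nonempty_iso_exTree6
  · exact key (by simp [extremalBranches]) φ nonempty_iso_exTree7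
  · exact key (by simp [extremalBranches]) φ nonempty_iso_exTree8
  · exact key (by simp [extremalBranches]) φ nonempty_iso_exTree9
  · exact key (by simp [extremalBranches]) φ nonempty_iso_exTree10
  · exact key (by simp [extremalBranches]) φ nonempty_iso_exTree11

/-- `insertMax` never invents an entry: the maximum of two sizes is one of them. So each entry comes
from an actual join, and the tables give attained values. -/
theorem JoinTree.realizes_of_mem_maxTable {t : JoinTree} {a : RootState} {m : ℕ}
    (h : (a, m) ∈ t.maxTable) : t.Realizes a m := by
  have insert {e : RootState × ℕ} : ∀ {l : List (RootState × ℕ)} {x : RootState × ℕ},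
      x ∈ insertMax e l → x = e ∨ x ∈ l := by
    intro l
    induction l with
    | nil => intro x hx; simpa [insertMax] using hx
    | cons y l ih =>
      intro x hx
      unfold insertMax at hx
      by_cases hy : y.1 = e.1
      · simp only [hy, beq_self_eq_true, cond_true, List.mem_cons] at hx
        obtain rfl | hx := hx
        · rcases le_total y.2 e.2 with h | h
          · simp [max_eq_right h]
          · simp [max_eq_left h, ← hy]
        · simp [hx]
      · have : (y.1 == e.1) = false := by simpa using hy
        simp only [this, cond_false, List.mem_cons] at hx
        obtain rfl | hx := hx
        · simp
        · have := ih hx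
          simp only [List.mem_cons]
          tauto
  have foldr : ∀ {l : List (RootState × ℕ)} {x : RootState × ℕ},
      x ∈ l.foldr insertMax [] → x ∈ l := by
    intro l
    induction l with
    | nil => intro x hx; simp at hx
    | cons y l ih =>
      intro x hx
      rw [List.foldr_cons] at hx
      exact List.mem_cons.2 ((insert hx).imp_right ih)
  induction t generalizing a m with
  | pt =>
    simp only [maxTable, List.mem_cons, Prod.mk.injEq, List.not_mem_nil, or_false] at h
    obtain ⟨rfl, rfl⟩ | ⟨rfl, rfl⟩ := h
    · exact realizes_pt_out
    · exact realizes_pt_in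
  | join t s iht ihs =>
    have := foldr h
    simp only [List.mem_flatMap, List.mem_filterMap] at this
    obtain ⟨x, hx, y, hy, hxy⟩ := this
    cases hc : x.1.clash y.1
    · simp only [hc, cond_false, Option.some.injEq, Prod.mk.injEq] at hxy
      obtain ⟨rfl, rfl⟩ := hxy
      exact (iht hx).join (ihs hy) hc
    · simp [hc] at hxy

/-- The value `(n - 1) / 3` is attained by some final state and exceeded by none. -/
theorem extremalBranches_maxTable : (extremalBranches.all fun u =>
    ((◦ ⋈ u).maxTable.any fun e => e.1.isFinal && decide (3 * e.2 + 1 = (◦ ⋈ u).size)) &&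
    (◦ ⋈ u).maxTable.all fun e => !e.1.isFinal || decide (3 * e.2 + 1 ≤ (◦ ⋈ u).size)) = true := by
  decide +kernel

/-- The largest number of vertices missed by an identifying code of an exceptional tree of maximum
degree three. -/
theorem isGreatest_of_isExceptional_three {V : Type*} [Fintype V] {G : SimpleGraph V}
    (hG : G.IsAcyclic) (h : IsExceptional 3 G) :
    ∃ m, 3 * m + 1 = Fintype.card V ∧ IsGreatest {k | HasCodeMissing G k} m := by
  obtain ⟨u, hu, ⟨φ⟩⟩ := exists_extremalBranch_of_isExceptional h
  have hG' := φ.isAcyclic_iff.1 hG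
  have ht := List.all_eq_true.1 extremalBranches_maxTable u hu
  rw [Bool.and_eq_true, List.any_eq_true] at ht
  obtain ⟨⟨⟨a, m⟩, he, hm⟩, hall⟩ := ht
  simp only [Bool.and_eq_true, decide_eq_true_eq] at hm
  refine ⟨m, ?_, (HasCodeMissing.map φ.symm)
    ((realizes_of_mem_maxTable he).hasCodeMissing hm.1 hG'), fun k hk => ?_⟩
  · rw [hm.2, ← card_vert, Fintype.card_congr φ.toEquiv]
  · refine le_of_hasCodeMissing hG' (List.all_eq_true.2 fun e he => ?_) (HasCodeMissing.map φ hk)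
    have := List.all_eq_true.1 hall e he
    simp only [Bool.or_eq_true, decide_eq_true_eq] at this ⊢
    exact this.imp_right fun h => by omega

end

/-! ### Stars -/

theorem JoinTree.size_star (k : ℕ) : (JoinTree.star k).size = k + 1 := by
  induction k with
  | zero => rfl
  | succ k ih => exact congrArg (· + 1) ih

/-- The root is adjacent to all other vertices, and there are no further edges. -/
def IsStarAt {V : Type*} (G : SimpleGraph V) (r : V) : Prop :=
  ∀ x y, G.Adj x y ↔ (x = r ∧ y ≠ r) ∨ (y = r ∧ x ≠ r)

theorem JoinTree.isStarAt_star (k : ℕ) : IsStarAt (JoinTree.star k).graph (JoinTree.star k).root := by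
  induction k with
  | zero => exact fun _ _ => ⟨fun h => h.elim, fun h => h.elim (fun h => h.2 rfl) fun h => h.2 rfl⟩
  | succ k ih =>
    have key : IsStarAt (joinRoots (star k).graph pt.graph (star k).root pt.root)
        (.inl (star k).root) := by
      rintro (x | x) (y | y)
      · simpa using ih x y
      · simp [show y = pt.root from rfl]
      · simp [show x = pt.root from rfl]
      · simp [show y = pt.root from rfl, show x = pt.root from rfl]
    exact key

theorem IsStarAt.joinRoots {V : Type*} {G : SimpleGraph V} {r : V} (h : IsStarAt G r) :
    IsStarAt (joinRoots (⊥ : SimpleGraph Unit) G () r) (.inr r) := by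
  rintro (x | x) (y | y)
  · simp
  · simp
  · simp
  · simpa using h x y

theorem IsStarAt.nonempty_iso {V : Type*} [Fintype V] {G : SimpleGraph V} {r : V}
    (h : IsStarAt G r) {k : ℕ} (hk : Fintype.card V = k + 1) :
    Nonempty (G ≃g completeBipartiteGraph (Fin 1) (Fin k)) := by
  classical
  have e₁ : {x // x = r} ≃ Fin 1 := Fintype.equivFinOfCardEq (Fintype.card_subtype_eq r)
  have e₂ : {x // ¬ x = r} ≃ Fin k := Fintype.equivFinOfCardEq (by
    rw [Fintype.card_subtype_compl, hk, Fintype.card_subtype_eq]; rfl)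
  refine ⟨⟨(Equiv.sumCompl (· = r)).symm.trans (Equiv.sumCongr e₁ e₂), ?_⟩⟩
  intro x y
  rw [h x y]
  by_cases hx : x = r <;> by_cases hy : y = r <;>
    simp [hx, hy, Equiv.sumCompl_symm_apply_of_pos, Equiv.sumCompl_symm_apply_of_neg]

/-- The leaves form a code. Conversely, a missed leaf needs the centre to dominate it, and two
missed leaves would both see only the centre. -/
theorem isGreatest_completeBipartiteGraph {k : ℕ} (hk : 2 ≤ k) :
    IsGreatest {m | HasCodeMissing (completeBipartiteGraph (Fin 1) (Fin k)) m} 1 := by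
  constructor
  · refine ⟨Finset.univ.map Function.Embedding.inr, ⟨?_, ?_⟩, ?_⟩
    · rintro (v | v)
      · exact .inr ⟨.inr ⟨0, by omega⟩, by simp, by simp⟩
      · exact .inl (by simp)
    · have other (v : Fin k) : ∃ w : Fin k, w ≠ v := by
        have : Nontrivial (Fin k) := Fin.nontrivial_iff_two_le.2 hk
        exact exists_ne v
      rintro (u | u) (v | v) huv
      -- The centre is separated from a leaf by any other leaf, which exists as `k ≥ 2`.
      · exact absurd (congrArg Sum.inl (Subsingleton.elim u v)) huv
      · obtain ⟨w, hw⟩ := other v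
        exact ⟨.inr w, by simp, by simp [closedNbhd, Xor, hw]⟩
      · obtain ⟨w, hw⟩ := other u
        exact ⟨.inr w, by simp, by simp [closedNbhd, Xor, hw]⟩
      · have huv : u ≠ v := fun h => huv (congrArg _ h)
        exact ⟨.inr u, by simp, by simp [closedNbhd, Xor, huv]⟩
    · simp [add_comm]
  · rintro m ⟨C, ⟨hd, hs⟩, hm⟩
    have : (Cᶜ).card ≤ 1 := by
      rw [Finset.card_le_one]
      have key (i : Fin k) (x : Fin 1 ⊕ Fin k) (hi : .inr i ∉ C) (hx : x ∉ C) : x = .inr i := by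
        obtain x | j := x
        · obtain h | ⟨w | w, hw, h⟩ := hd (.inr i)
          · exact absurd h hi
          · rw [Subsingleton.elim w x] at hw
            exact absurd hw hx
          · simp at h
        · by_contra hij
          obtain ⟨w | w, hw, h⟩ := hs _ _ hij
          · simp [closedNbhd, Xor] at h
          · simp only [closedNbhd, Xor, Set.mem_ofPred_eq] at h
            simp only [Sum.inr.injEq, completeBipartiteGraph_adj] at h
            simp at h
            obtain ⟨rfl, -⟩ | ⟨rfl, -⟩ := h
            · exact hx hw
            · exact hi hw
      rintro (a | a) ha (b | b) hb <;> rw [Finset.mem_compl] at ha hb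
      · exact congrArg _ (Subsingleton.elim a b)
      · exact key b _ hb ha
      · exact (key a _ ha hb).symm
      · exact key b _ hb ha
    rw [Finset.card_compl] at this
    omega

/-! ### The main theorem -/

theorem isGreatest_hasCodeMissing_iff_of_iso {V W : Type*} [Fintype V] [Fintype W]
    {G : SimpleGraph V} {H : SimpleGraph W} (φ : G ≃g H) (m : ℕ) :
    IsGreatest {k | HasCodeMissing G k} m ↔ IsGreatest {k | HasCodeMissing H k} m := by
  have : {k | HasCodeMissing G k} = {k | HasCodeMissing H k} :=
    Set.ext fun k => ⟨HasCodeMissing.map φ, HasCodeMissing.map φ.symm⟩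
  rw [this]

theorem HasCodeMissing.identificationNumber_add_le {V : Type*} [Fintype V] {G : SimpleGraph V}
    {m : ℕ} (h : HasCodeMissing G m) : identificationNumber G + m ≤ Fintype.card V := by
  obtain ⟨C, hC, hm⟩ := h
  have hmem : C.card ∈ {k | ∃ C : Finset V, IsIdentifyingCode G C ∧ C.card = k} := ⟨C, hC, rfl⟩
  rw [← hm]
  exact Nat.add_le_add_right (Nat.sInf_le hmem) m

theorem identificationNumber_add_eq {V : Type*} [Fintype V] {G : SimpleGraph V} {m : ℕ}
    (h : IsGreatest {k | HasCodeMissing G k} m) :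
    identificationNumber G + m = Fintype.card V := by
  obtain ⟨C, hC, hm⟩ : HasCodeMissing G m := h.1
  refine le_antisymm (HasCodeMissing.identificationNumber_add_le ⟨C, hC, hm⟩) ?_
  have hne : {k | ∃ C : Finset V, IsIdentifyingCode G C ∧ C.card = k}.Nonempty := ⟨_, C, hC, rfl⟩
  obtain ⟨C', hC', hcard⟩ : ∃ C', IsIdentifyingCode G C' ∧ C'.card = identificationNumber G :=
    Nat.sInf_mem hne
  -- A minimum code misses as many vertices as possible.
  have := h.2 (show HasCodeMissing G (Fintype.card V - C'.card) from
    ⟨C', hC', by have := C'.card_le_univ; omega⟩)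
  omega

theorem isGreatest_of_isExceptional {V : Type*} [Fintype V] {G : SimpleGraph V} {Δ : ℕ}
    (hG : G.IsAcyclic) (hΔ : 3 ≤ Δ) (h : IsExceptional Δ G) :
    ∃ m, Δ * m + 1 = Fintype.card V ∧ IsGreatest {k | HasCodeMissing G k} m := by
  obtain rfl | hne := eq_or_ne Δ 3
  · exact isGreatest_of_isExceptional_three hG h
  · obtain ⟨T, hT, ⟨φ⟩⟩ := h
    simp only [exceptionalTrees, hne, if_false, Set.mem_singleton_iff] at hT
    subst hT
    exact ⟨1, by rw [Fintype.card_congr φ.toEquiv]; simp [add_comm],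
      (isGreatest_hasCodeMissing_iff_of_iso φ 1).2 (isGreatest_completeBipartiteGraph (by omega))⟩

theorem isExceptional_or_exists_hasCodeMissing {V : Type*} [Fintype V] {G : SimpleGraph V}
    [DecidableRel G.Adj] {Δ : ℕ} (hG : G.IsTree) (hmax : G.maxDegree = Δ) (hΔ : 3 ≤ Δ) :
    IsExceptional Δ G ∨ ∃ m, HasCodeMissing G m ∧ Fintype.card V ≤ Δ * m := by
  have := hG.connected.nonempty
  obtain ⟨v, hv⟩ := G.exists_maximal_degree_vertex
  rw [hmax] at hv
  have hcard : Δ + 1 ≤ Fintype.card V := hv ▸ G.degree_lt_card_verts v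
  have : Nontrivial V := Fintype.one_lt_card_iff_nontrivial.1 (by omega)
  have hncard (w : V) : (G.neighborSet w).ncard = G.degree w := by
    rw [Set.ncard_eq_toFinset_card']; rfl
  obtain ⟨t, ⟨φ⟩, ht, hk⟩ := JoinTree.exists_iso_join_pt (Δ := Δ) hG
    fun w => by rw [hncard, ← hmax]; exact G.degree_le_maxDegree w
  have hsize : Fintype.card V = (JoinTree.pt.join t).size := by
    rw [← JoinTree.card_vert, Fintype.card_congr φ.toEquiv]
  have hG' := φ.isAcyclic_iff.1 hG.isAcyclic
  have finish (h : ∃ m, HasCodeMissing (JoinTree.pt.join t).graph m ∧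
      (JoinTree.pt.join t).size ≤ Δ * m) :
      ∃ m, HasCodeMissing G m ∧ Fintype.card V ≤ Δ * m := by
    obtain ⟨m, hm, hle⟩ := h
    exact ⟨m, hm.map φ.symm, hsize ▸ hle⟩
  obtain rfl | hne := eq_or_ne Δ 3
  · obtain h | h | h | ⟨u, hu, h⟩ := ht.exists_hasCodeMissing_three hk hG'
    · exact .inr (finish h)
    all_goals
      obtain ⟨ψ, -⟩ := JoinTree.Similar.join (.refl .pt) h
      have χ := φ.trans ψ
    -- The path on two vertices has too few vertices for a vertex of degree three.
    · have := Fintype.card_congr χ.toEquiv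
      rw [JoinTree.card_vert] at this
      simp only [JoinTree.size] at this
      omega
    -- The path on four vertices has no vertex of degree three; its degrees are bounded by
    -- evaluation.
    · have h1 : (SimpleGraph.neighborSet _ (χ v)).ncard = (G.neighborSet v).ncard :=
        (Nat.card_congr (SimpleGraph.Iso.mapNeighborSet χ v)).symm
      have h2 := (JoinTree.ncard_neighborSet_le _ (χ v)).trans
        (show _ ≤ 2 from of_decide_eq_true (List.all_eq_true.1 (show (List.all (JoinTree.verts
          (.join .pt (.join .pt (.join .pt .pt)))) fun v => decide ((List.filter (JoinTree.isAdj
            (.join .pt (.join .pt (.join .pt .pt))) v) (JoinTree.verts _)).length ≤ 2)) = true by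
          decide) _ (JoinTree.mem_verts _ (χ v))))
      rw [h1, hncard] at h2
      omega
    · obtain ⟨T, hT, ⟨ω⟩⟩ := isExceptional_of_mem_extremalBranches hu
      exact .inl ⟨T, hT, ⟨χ.trans ω⟩⟩
  · obtain h | h := ht.exists_hasCodeMissing (by omega) hk hG'
    · left
      have hs : IsStarAt t.graph t.root := by rw [h]; exact JoinTree.isStarAt_star _
      have hts : t.size = t.kids + 1 := by
        have := JoinTree.size_star t.kids
        rwa [← h] at this
      -- The vertex of degree `Δ` forces at least `Δ + 1` vertices, and the bound on the children of
      -- the root allows no more.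
      have hV : (JoinTree.pt.join t).size = Δ + 1 := by
        simp only [JoinTree.size] at hsize ⊢
        omega
      obtain ⟨ψ⟩ := IsStarAt.nonempty_iso (G := (JoinTree.pt.join t).graph) hs.joinRoots
        ((JoinTree.card_vert _).trans hV)
      exact ⟨_, by simp only [exceptionalTrees, hne, if_false]; rfl, ⟨φ.trans ψ⟩⟩
    · exact .inr (finish h)

theorem theorem1 {V : Type*} [Fintype V] (G : SimpleGraph V) [DecidableRel G.Adj]
    (n Δ : ℕ) (hG : G.IsTree) (hn : Fintype.card V = n) (hmax : G.maxDegree = Δ)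
    (hΔ : 3 ≤ Δ) :
    (∃ C : Finset V, IsIdentifyingCode G C) ∧
    (IsExceptional Δ G →
      (identificationNumber G : ℝ) = ((Δ : ℝ) - 1) / (Δ : ℝ) * (n : ℝ) + 1 / (Δ : ℝ)) ∧
    (¬ IsExceptional Δ G →
      (identificationNumber G : ℝ) ≤ ((Δ : ℝ) - 1) / (Δ : ℝ) * (n : ℝ)) ∧
    (identificationNumber G : ℝ) ≤ ((Δ : ℝ) - 1) / (Δ : ℝ) * (n : ℝ) + 1 / (Δ : ℝ) := by
  subst hn
  have hpos : (0 : ℝ) < Δ := by exact_mod_cast (by omega : 0 < Δ)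
  have hexc (h : IsExceptional Δ G) : (identificationNumber G : ℝ) =
      ((Δ : ℝ) - 1) / Δ * (Fintype.card V : ℝ) + 1 / Δ := by
    obtain ⟨m, hm, hgr⟩ := isGreatest_of_isExceptional hG.isAcyclic hΔ h
    have h1 : (identificationNumber G : ℝ) + m = Fintype.card V := by
      exact_mod_cast identificationNumber_add_eq hgr
    have h2 : (Δ : ℝ) * m + 1 = Fintype.card V := by exact_mod_cast hm
    field_simp
    linear_combination (Δ : ℝ) * h1 - h2
  have hnot (h : ¬ IsExceptional Δ G) :
      (identificationNumber G : ℝ) ≤ ((Δ : ℝ) - 1) / Δ * (Fintype.card V : ℝ) := by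
    obtain ⟨m, hm, hle⟩ := (isExceptional_or_exists_hasCodeMissing hG hmax hΔ).resolve_left h
    have h1 : (identificationNumber G : ℝ) + m ≤ Fintype.card V := by
      exact_mod_cast hm.identificationNumber_add_le
    have h2 : (Fintype.card V : ℝ) ≤ Δ * m := by exact_mod_cast hle
    rw [div_mul_eq_mul_div, le_div_iff₀ hpos]
    nlinarith
  refine ⟨?_, hexc, hnot, ?_⟩
  · by_cases h : IsExceptional Δ G
    · obtain ⟨m, -, ⟨C, hC, -⟩, -⟩ := isGreatest_of_isExceptional hG.isAcyclic hΔ h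
      exact ⟨C, hC⟩
    · obtain ⟨m, ⟨C, hC, -⟩, -⟩ :=
        (isExceptional_or_exists_hasCodeMissing hG hmax hΔ).resolve_left h
      exact ⟨C, hC⟩
  · by_cases h : IsExceptional Δ G
    · exact (hexc h).le
    · exact (hnot h).trans (le_add_of_nonneg_right (by positivity))
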